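/- Consider a $K$-tier cellular network ($K\ge 1$) seen from a typical user at the origin of the plane. The base stations (BSs) of tier $j\in\{1,\dots,K\}$ form a homogeneous Poisson point process in $\mathbb R^2$ of density $\lambda_{b,j}>0$, and the tiers are independent. Let $h_j=h_{b,j}-h_u\ge 0$ be the difference between the antenna heights of the tier-$j$ BSs and the user; a tier-$j$ BS at horizontal distance $y$ from the user has link distance $x=\sqrt{y^2+h_j^2}$. Given all the positions, the channels of the BSs are independent, and a tier-$j$ BS at link distance $x$ has channel $c\in\{\mathrm L,\mathrm N\}$ (LoS/NLoS) with probability $p_j^{(c)}(x)$, where $p_j^{(\mathrm L)}$ is any measurable $[0,1]$-valued function and $p_j^{(\mathrm N)}=1-p_j^{(\mathrm L)}$; when $h_j>0$ this includes the blockage model $p_j^{(\mathrm L)}(x)=\Big(1-\sqrt{\tfrac{\pi}{2}}\tfrac{\rho}{h_j}\big[\operatorname{erf}(\tfrac{h_{b,j}}{\rho\sqrt2})-\operatorname{erf}(\tfrac{h_u}{\rho\sqrt2})\big]\Big)^{\sqrt{\varepsilon\Upsilon(x^2-h_j^2)}}$ with $\rho>0$ and $\varepsilon,\Upsilon\ge0$.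 A tier-$j$ BS with channel $c$ at link distance $x$ has average received link power (ARLP) $\varsigma_j x^{-\alpha^{(c)}}$, where $\varsigma_j>0$ and $\alpha^{(c)}\ge 2$. The main link BS is the BS with the largest ARLP; almost surely it exists and is unique. If it is in tier $k$, the cooperating BSs (the main link BS included) are the BSs, say of tier $j$, whose ARLP divided by that of the main link BS is at least $\eta_{j,k}$, where $\eta_{j,k}\in(0,1]$. For $r>0$ let $\theta_{j}^{(c)}(r,k,c_o)=\left(\frac{\varsigma_j}{\varsigma_k}\right)^{1/\alpha^{(c)}} r^{\alpha^{(c_o)}/\alpha^{(c)}}$, and read $\int_a^b$ as $0$ when $b<a$. Let $\mathcal A_k^{(c_o)}$ be the probability that the main link BS is in tier $k$ with channel $c_o$, and let $f_{X_{k,o}^{(c_o)}}$ be the probability density of the main link distance conditional on this event; they are given by $$\mathcal A_k^{(c_o)}=\int_{h_k}^\infty 2\pi\lambda_{b,k}\,x\,p_k^{(c_o)}(x)\,e^{-2\pi\sum_{j=1}^K\lambda_{b,j}\sum_{c\in\{\mathrm L,\mathrm N\}}\int_{h_j}^{\theta_j^{(c)}(x,k,c_o)}t\,p_j^{(c)}(t)\,dt}\,dx,$$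 $$f_{X_{k,o}^{(c_o)}}(r)=\frac{2\pi\lambda_{b,k}}{\mathcal A_k^{(c_o)}}\,r\,p_k^{(c_o)}(r)\,e^{-2\pi\sum_{j=1}^K\lambda_{b,j}\sum_{c\in\{\mathrm L,\mathrm N\}}\int_{h_j}^{\theta_j^{(c)}(r,k,c_o)}t\,p_j^{(c)}(t)\,dt}\qquad(r\ge h_k),$$ with $f_{X_{k,o}^{(c_o)}}=0$ if $\mathcal A_k^{(c_o)}=0$. Then the average number (expectation) of cooperating BSs is finite and equals $$N_{\mathrm{avg}}=\sum_{k=1}^K\sum_{c_o\in\{\mathrm L,\mathrm N\}}\mathcal A_k^{(c_o)}\int_{h_k}^\infty f_{X_{k,o}^{(c_o)}}(r)\sum_{j=1}^K 2\pi\lambda_{b,j}\sum_{c\in\{\mathrm L,\mathrm N\}}\int_{h_j}^{\theta_j^{(c)}(r,k,c_o)\,\eta_{j,k}^{-1/\alpha^{(c)}}}t\,p_j^{(c)}(t)\,dt\,dr .$$ -/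

import Mathlib

open MeasureTheory ProbabilityTheory Set
open scoped ENNReal NNReal

noncomputable section

namespace UDN

/-- Channel environment of a link: line of sight or non line of sight. -/
inductive Channel
  | los
  | nlos
  deriving DecidableEq

instance : Fintype Channel :=
  ⟨{Channel.los, Channel.nlos}, fun c => by cases c <;> simp⟩

/-- The horizontal plane; the typical user stands at its origin. -/
abbrev Plane : Type := EuclideanSpace ℝ (Fin 2)

/-! ### Line-of-sight probability -/

/-- A line-of-sight probability, as a function of the link distance (any measurable function with
values in `[0, 1]`; the blockage model is `LosFunction.blockage`). -/
structure LosFunction where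
  prob : ℝ → ℝ
  measurable_prob : Measurable prob
  prob_nonneg : ∀ x, 0 ≤ prob x
  prob_le_one : ∀ x, prob x ≤ 1

/-- The error function. -/
def erf (z : ℝ) : ℝ := 1 / √Real.pi * ∫ t in (-z)..z, Real.exp (-t ^ 2)

/-- The probability that a single building does not obstruct the link between a base station
antenna of height `hb` and a user antenna of height `hu`, when `ρ` is the average building
height. -/
def clearProb (ρ hb hu : ℝ) : ℝ :=
  1 - √(Real.pi / 2) * (ρ / (hb - hu)) * (erf (hb / (ρ * √2)) - erf (hu / (ρ * √2)))

theorem clearProb_mem {ρ hb hu : ℝ} (hρ : 0 < ρ) (h : hu < hb) :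
    0 ≤ clearProb ρ hb hu ∧ clearProb ρ hb hu ≤ 1 := by
  have hs : (0 : ℝ) < √2 := by positivity
  have hp : (0 : ℝ) < √Real.pi := Real.sqrt_pos.2 Real.pi_pos
  set a := hu / (ρ * √2) with ha
  set b := hb / (ρ * √2) with hb'
  have hab : a ≤ b := by rw [ha, hb']; gcongr
  have hc : ∀ x y : ℝ, IntervalIntegrable (fun t : ℝ => Real.exp (-t ^ 2)) volume x y :=
    fun x y => (by fun_prop : Continuous fun t : ℝ => Real.exp (-t ^ 2)).intervalIntegrable x y
  have hneg : ∫ t in (-b)..(-a), Real.exp (-t ^ 2) = ∫ t in a..b, Real.exp (-t ^ 2) := by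
    rw [← intervalIntegral.integral_comp_neg]
    simp
  have hsplit : ∫ t in (-b)..b, Real.exp (-t ^ 2)
      = (∫ t in (-a)..a, Real.exp (-t ^ 2)) + 2 * ∫ t in a..b, Real.exp (-t ^ 2) := by
    rw [← intervalIntegral.integral_add_adjacent_intervals (hc (-b) (-a)) (hc (-a) b),
      ← intervalIntegral.integral_add_adjacent_intervals (hc (-a) a) (hc a b), hneg]
    ring
  have h0 : 0 ≤ ∫ t in a..b, Real.exp (-t ^ 2) :=
    intervalIntegral.integral_nonneg hab fun t _ => (Real.exp_pos _).le
  have h1 : ∫ t in a..b, Real.exp (-t ^ 2) ≤ b - a := by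
    have := intervalIntegral.integral_mono_on hab (hc a b)
      (intervalIntegrable_const (c := (1 : ℝ))) (fun t _ => by
        simpa using Real.exp_le_one_iff.2 (by nlinarith [sq_nonneg t] : -t ^ 2 ≤ 0))
    simpa using this
  have hI : √(Real.pi / 2) * (ρ / (hb - hu)) * (erf b - erf a)
      = (ρ * √2 / (hb - hu)) * ∫ t in a..b, Real.exp (-t ^ 2) := by
    have h2 : (√2) ^ 2 = (2 : ℝ) := Real.sq_sqrt (by norm_num)
    have hd : hb - hu ≠ 0 := (sub_pos.2 h).ne'
    unfold erf
    rw [hsplit, Real.sqrt_div Real.pi_pos.le]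
    field_simp
    rw [h2]
    ring
  have hd : 0 < hb - hu := sub_pos.2 h
  have hba : (ρ * √2 / (hb - hu)) * (b - a) = 1 := by
    rw [ha, hb', ← sub_div]
    field_simp
  have hk : 0 ≤ ρ * √2 / (hb - hu) := by positivity
  unfold clearProb
  rw [hI]
  constructor
  · have := mul_le_mul_of_nonneg_left h1 hk
    linarith
  · have := mul_nonneg hk h0
    linarith

/-- The line-of-sight probability of the blockage model, for base station antenna height `hb`,
user antenna height `hu`, average building height `ρ`, fraction `ε` of the area covered by
buildings, and average number `υ` of buildings per unit area. -/
def LosFunction.blockage (ρ ε υ hb hu : ℝ) (hρ : 0 < ρ) (h : hu < hb) : LosFunction where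
  prob x := clearProb ρ hb hu ^ √(ε * υ * (x ^ 2 - (hb - hu) ^ 2))
  measurable_prob := by fun_prop
  prob_nonneg _ := Real.rpow_nonneg (clearProb_mem hρ h).1 _
  prob_le_one _ := Real.rpow_le_one (clearProb_mem hρ h).1 (clearProb_mem hρ h).2
    (Real.sqrt_nonneg _)

/-! ### Parameters of the network -/

/-- The parameters of a `K`-tier network with relative-received-link-power cooperation. -/
structure Network (K : ℕ) where
  /-- spatial density of the base stations of each tier -/
  density : Fin K → ℝ
  density_pos : ∀ j, 0 < density j
  /-- antenna height of the base stations of each tier -/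
  bsHeight : Fin K → ℝ
  /-- antenna height of the users -/
  userHeight : ℝ
  userHeight_le : ∀ j, userHeight ≤ bsHeight j
  /-- downlink transmit power of each tier -/
  txPower : Fin K → ℝ
  txPower_pos : ∀ j, 0 < txPower j
  /-- pathloss exponent of each channel environment -/
  pathloss : Channel → ℝ
  two_le_pathloss : ∀ c, 2 ≤ pathloss c
  /-- line-of-sight probability of the links to the base stations of each tier -/
  los : Fin K → LosFunction
  /-- `threshold j k` is the least fraction of the average received power of a main link from
  tier `k` that a base station of tier `j` needs in order to cooperate -/
  threshold : Fin K → Fin K → ℝ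
  threshold_pos : ∀ j k, 0 < threshold j k
  threshold_le_one : ∀ j k, threshold j k ≤ 1

namespace Network

variable {K : ℕ} (N : Network K)

/-- Difference of the antenna heights of tier `j` and the user. -/
def height (j : Fin K) : ℝ := N.bsHeight j - N.userHeight

/-- Probability of channel environment `c` at link distance `x` in tier `j`. -/
def chanProb (j : Fin K) : Channel → ℝ → ℝ
  | .los, x => (N.los j).prob x
  | .nlos, x => 1 - (N.los j).prob x

/-- Link distance between the typical user and a base station of tier `j` whose horizontal
position is `y`. -/
def linkDist (j : Fin K) (y : Plane) : ℝ := √(‖y‖ ^ 2 + N.height j ^ 2)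

/-- Average received link power from a base station of tier `j` with channel `c` at link
distance `x` (the fading gain has mean one). -/
def avgPower (j : Fin K) (c : Channel) (x : ℝ) : ℝ := N.txPower j * x ^ (-N.pathloss c)

/-- The link distance at which a base station of tier `j` with channel `c` has the same average
received power as one of tier `k` with channel `c₀` at link distance `r`. -/
def theta (j : Fin K) (c : Channel) (k : Fin K) (c₀ : Channel) (r : ℝ) : ℝ :=
  (N.txPower j / N.txPower k) ^ (1 / N.pathloss c) * r ^ (N.pathloss c₀ / N.pathloss c)

/-- `∑ⱼ 2πλⱼ ∑_c ∫ t p_j^c(t) dt`, the integral being over `h_j ≤ t ≤ R j c` (it is `0` when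
`R j c < h_j`). -/
def meanCount (R : Fin K → Channel → ℝ) : ℝ :=
  ∑ j, 2 * Real.pi * N.density j * ∑ c, ∫ t in Icc (N.height j) (R j c), t * N.chanProb j c t

/-- `2 π λ_k r p_k^{c₀}(r) exp(-∑ⱼ 2πλⱼ ∑_c ∫_{h_j}^{θ} t p_j^c(t) dt)`. -/
def mainLinkWeight (k : Fin K) (c₀ : Channel) (r : ℝ) : ℝ :=
  2 * Real.pi * N.density k * r * N.chanProb k c₀ r *
    Real.exp (-N.meanCount fun j c => N.theta j c k c₀ r)

/-- The association probability `A_k^{c₀}`. -/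
def assocProb (k : Fin K) (c₀ : Channel) : ℝ :=
  ∫ r in Ici (N.height k), N.mainLinkWeight k c₀ r

/-- The probability density `f` of the main link distance, on `[h_k, ∞)`. -/
def mainLinkPdf (k : Fin K) (c₀ : Channel) (r : ℝ) : ℝ :=
  N.mainLinkWeight k c₀ r / N.assocProb k c₀

/-- `∑ⱼ 2πλⱼ ∑_c ∫_{h_j}^{θ η^{-1/α}} t p_j^c(t) dt`. -/
def coopMean (k : Fin K) (c₀ : Channel) (r : ℝ) : ℝ :=
  N.meanCount fun j c => N.theta j c k c₀ r * N.threshold j k ^ (-1 / N.pathloss c)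

end Network

/-! ### The random deployment -/

section Random

variable {Ω : Type*} [MeasurableSpace Ω]

/-- The number of points of the sequence `Y` that lie in `B`. -/
def count (Y : ℕ → Ω → Plane) (B : Set Plane) (ω : Ω) : ℕ∞ := {i | Y i ω ∈ B}.encard

/-- The points `Y 0, Y 1, …` form a homogeneous Poisson point process of intensity `lam`. -/
structure IsHPPP (P : Measure Ω) (Y : ℕ → Ω → Plane) (lam : ℝ) : Prop where
  measurable : ∀ i, Measurable (Y i)
  poisson : ∀ B : Set Plane, MeasurableSet B → volume B < ∞ → ∀ n : ℕ,
    P {ω | count Y B ω = n} = poissonMeasure (Real.toNNReal (lam * volume.real B)) {n}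
  indep : ∀ (n : ℕ) (B : Fin n → Set Plane), (∀ i, MeasurableSet (B i)) →
    Pairwise (fun i i' => Disjoint (B i) (B i')) → iIndepFun (fun i => count Y (B i)) P

variable {K : ℕ}

/-- `Y j i` is the horizontal position and `C j i` the channel environment of the `i`-th base
station of tier `j`. The tiers are independent homogeneous Poisson point processes, and given
all positions the channel environments are independent, with the probabilities that the network
prescribes at the respective link distances. -/
structure IsDeployment (N : Network K) (P : Measure Ω) (Y : Fin K → ℕ → Ω → Plane)
    (C : Fin K → ℕ → Ω → Channel) : Prop where
  hppp : ∀ j, IsHPPP P (Y j) (N.density j)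
  indep_tiers : iIndepFun (fun j ω i => Y j i ω) P
  measurable_channel : ∀ j i c, MeasurableSet {ω | C j i ω = c}
  channel : ∀ (S : Finset (Fin K × ℕ)) (c : Fin K × ℕ → Channel),
    P⟦{ω | ∀ s ∈ S, C s.1 s.2 ω = c s} |
        MeasurableSpace.comap (fun ω j i => Y j i ω) inferInstance⟧
      =ᵐ[P] fun ω => ∏ s ∈ S, N.chanProb s.1 (c s) (N.linkDist s.1 (Y s.1 s.2 ω))

/-- Average received link power of base station `s` (tier and index). -/
def arlp (N : Network K) (Y : Fin K → ℕ → Ω → Plane) (C : Fin K → ℕ → Ω → Channel)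
    (s : Fin K × ℕ) (ω : Ω) : ℝ :=
  N.avgPower s.1 (C s.1 s.2 ω) (N.linkDist s.1 (Y s.1 s.2 ω))

/-- Base station `m` is the main link base station: its average received power is strongest. -/
def IsMain (N : Network K) (Y : Fin K → ℕ → Ω → Plane) (C : Fin K → ℕ → Ω → Channel)
    (m : Fin K × ℕ) (ω : Ω) : Prop :=
  ∀ s, arlp N Y C s ω ≤ arlp N Y C m ω

/-- The event that the main link base station belongs to tier `k`, has channel environment `c₀`,
and has its link distance in `B`. -/
def mainEvent (N : Network K) (Y : Fin K → ℕ → Ω → Plane) (C : Fin K → ℕ → Ω → Channel)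
    (k : Fin K) (c₀ : Channel) (B : Set ℝ) : Set Ω :=
  {ω | ∃ i, IsMain N Y C (k, i) ω ∧ C k i ω = c₀ ∧ N.linkDist k (Y k i ω) ∈ B}

/-- The set of cooperating base stations: those whose average received power, relative to that
of the main link base station, reaches the threshold. -/
def coopSet (N : Network K) (Y : Fin K → ℕ → Ω → Plane) (C : Fin K → ℕ → Ω → Channel)
    (ω : Ω) : Set (Fin K × ℕ) :=
  {s | ∃ m, IsMain N Y C m ω ∧ N.threshold s.1 m.1 ≤ arlp N Y C s ω / arlp N Y C m ω}

/-- The number of cooperating base stations. -/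
def coopCount (N : Network K) (Y : Fin K → ℕ → Ω → Plane) (C : Fin K → ℕ → Ω → Channel)
    (ω : Ω) : ℝ≥0∞ :=
  ((coopSet N Y C ω).encard : ℝ≥0∞)

end Random

end UDN

end

/-! Regard every base station as a point z = (tier, channel, position). By independent marking and
superposition these points form a Poisson process with intensity measure ν = `intensity`
(`isPoissonCloud`). Let u(z) = `level` be the ν-mass of the points at least as strong as z. Then u
carries ν to Lebesgue measure on [0, ∞) (`isLevel`), and almost surely the main link base station is
the unique point of least level. There is no point up to level u(z) with probability exp(-u(z)), so
the first point has law exp(-u) dν; in polar coordinates, on one tier and one channel, this is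
`mainLinkWeight` (`measure_mainEvent`). The points after the first are still Poisson: the pairs
(first point, other point) have intensity exp(-u(z)) ν(dz) ν(dz') on u(z) < u(z')
(`tsum_measure_isFirst_pair`).

Hence the mean number of cooperating stations is 1, for the main link station, plus the integral of
exp(-u(z)) ν{z' : u(z') > u(z), z' passes the threshold of z}. The claimed formula integrates
instead the ν-mass of all z' that pass the threshold, including levels up to u(z); since thresholds
are at most 1, that surplus is exactly u(z) (`coopMean_eq_level_add`). The two agree because ∫ u
exp(-u) dν = ∫ t exp(-t) dt = 1 (`IsLevel.lintegral_exp_neg_mul`): the surplus accounts for the main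
link station. Finiteness holds because `coopMean` grows at most like a power of r, while
`mainLinkWeight` decays like exp(-b r^p) up to a factor r.

Of the Poisson property only void probabilities and mean counts are used (`IsPoissonCloud`). The
bridge between them is a grid of level cells of ν-mass δ: whether a cell is occupied is a void
event, and the mean number of occupied cells agrees with the mean number of points up to a factor
exp(δ). Letting δ tend to 0 gives the absence of ties, the vanishing correlation between a count and
the emptiness of a disjoint set, and the law of the first point. -/

noncomputable section

namespace UDN

/-! ### Counts and void events of a Poisson cloud; the grid of level cells. -/

section Cloud

variable {ι Ω E : Type*}

/-- The number of points of the family `Z` in `A`, as an extended nonnegative real. -/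
def hits (Z : ι → Ω → E) (A : Set E) (ω : Ω) : ℝ≥0∞ := ∑' i, A.indicator 1 (Z i ω)

/-- The event that no point of the family `Z` lies in `A`. -/
def avoid (Z : ι → Ω → E) (A : Set E) : Set Ω := {ω | ∀ i, Z i ω ∉ A}

theorem avoid_union (Z : ι → Ω → E) (A B : Set E) : avoid Z (A ∪ B) = avoid Z A ∩ avoid Z B := by
  ext ω
  simp [avoid, not_or, forall_and]

theorem hits_iUnion (Z : ι → Ω → E) {S : ℕ → Set E} (hS : Pairwise (Function.onFun Disjoint S))
    (ω : Ω) : hits Z (⋃ n, S n) ω = ∑' n, hits Z (S n) ω := by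
  unfold hits
  rw [ENNReal.tsum_comm]
  refine tsum_congr fun i => ?_
  by_cases h : ∃ n, Z i ω ∈ S n
  · obtain ⟨n, hn⟩ := h
    rw [tsum_eq_single n fun m hm => indicator_of_notMem
      (fun h' => Set.disjoint_left.1 (hS hm) h' hn) _, indicator_of_mem hn,
      indicator_of_mem (mem_iUnion.2 ⟨n, hn⟩)]
  · rw [indicator_of_notMem (by simpa using h)]
    push Not at h
    simp [h]

theorem one_le_hits {Z : ι → Ω → E} {A : Set E} {ω : Ω} (h : ω ∉ avoid Z A) : 1 ≤ hits Z A ω := by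
  simp only [avoid, mem_ofPred_eq, not_forall, not_not] at h
  obtain ⟨i, hi⟩ := h
  calc (1 : ℝ≥0∞) = A.indicator 1 (Z i ω) := by simp [hi]
    _ ≤ _ := ENNReal.le_tsum i

theorem two_le_hits {Z : ι → Ω → E} {A : Set E} {ω : Ω} {i i' : ι} (hne : i ≠ i')
    (h : Z i ω ∈ A) (h' : Z i' ω ∈ A) : 2 ≤ hits Z A ω := by
  classical
  calc (2 : ℝ≥0∞) = ∑ j ∈ {i, i'}, A.indicator 1 (Z j ω) := by
        rw [Finset.sum_pair hne]; simp [h, h']; norm_num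
    _ ≤ _ := ENNReal.sum_le_tsum _

theorem measure_inter_compl_eq_mul {_ : MeasurableSpace Ω} {P : Measure Ω} [IsProbabilityMeasure P]
    {F G : Set Ω} (hG : MeasurableSet G) (h : P (F ∩ G) = P F * P G) :
    P (F ∩ Gᶜ) = P F * P Gᶜ := by
  have h1 : P (F ∩ G) + P (F ∩ Gᶜ) = P F := by
    rw [← sdiff_eq, measure_inter_add_sdiff F hG]
  have h2 : P F * P G + P F * P Gᶜ = P F := by
    rw [← mul_add, prob_add_prob_compl hG, mul_one]
  rw [← h2, h] at h1
  exact (ENNReal.add_right_inj (ENNReal.mul_ne_top (measure_ne_top _ _) (measure_ne_top _ _))).1 h1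

/-- Level sets of `u` with values in the cells of a grid of mesh `δ`. -/
def cell (u : E → ℝ) (δ : ℝ) (n : ℕ) : Set E := {z | n * δ < u z ∧ u z ≤ (n + 1) * δ}

theorem cell_unique {u : E → ℝ} {δ : ℝ} (hδ : 0 < δ) {z z' : E} {n m : ℕ} (h : u z = u z')
    (hz : z ∈ cell u δ n) (hz' : z' ∈ cell u δ m) : n = m := by
  obtain ⟨h1, h2⟩ := hz
  obtain ⟨h3, h4⟩ := hz'
  rw [h] at h1 h2
  have h5 : (n : ℝ) < m + 1 := lt_of_mul_lt_mul_right (h1.trans_le h4) hδ.le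
  have h6 : (m : ℝ) < n + 1 := lt_of_mul_lt_mul_right (h3.trans_le h2) hδ.le
  norm_cast at h5 h6
  omega

theorem pairwise_disjoint_cell (u : E → ℝ) {δ : ℝ} (hδ : 0 < δ) :
    Pairwise (Function.onFun Disjoint (cell u δ)) := fun _ _ hnm =>
  Set.disjoint_left.2 fun _ hz hz' => hnm (cell_unique hδ rfl hz hz')

theorem exists_mem_cell {u : E → ℝ} {δ : ℝ} (hδ : 0 < δ) {z : E} (hz : 0 < u z) :
    ∃ n, z ∈ cell u δ n := by
  have hpos : 0 < u z / δ := div_pos hz hδ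
  have hc : 0 < ⌈u z / δ⌉₊ := Nat.ceil_pos.2 hpos
  obtain ⟨n, hn⟩ := Nat.exists_eq_succ_of_ne_zero hc.ne'
  refine ⟨n, ?_, ?_⟩
  · rw [← lt_div_iff₀ hδ]
    exact Nat.lt_ceil.1 (by omega)
  · rw [← div_le_iff₀ hδ]
    have := Nat.le_ceil (u z / δ)
    rw [hn] at this
    exact_mod_cast this

theorem iUnion_inter_cell {u : E → ℝ} {δ : ℝ} (hδ : 0 < δ) (D : Set E) :
    ⋃ n, D ∩ cell u δ n = D ∩ {z | 0 < u z} := by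
  ext z
  simp only [mem_iUnion, mem_inter_iff, mem_ofPred_eq]
  constructor
  · rintro ⟨n, h, h', -⟩
    exact ⟨h, lt_of_le_of_lt (by positivity) h'⟩
  · rintro ⟨h, h'⟩
    obtain ⟨n, hn⟩ := exists_mem_cell hδ h'
    exact ⟨n, h, hn⟩

/-- A bound that holds up to factors `exp δ` with arbitrarily small `δ` holds exactly. -/
theorem le_of_forall_le_exp_mul {x y : ℝ≥0∞}
    (h : ∀ δ : ℝ, 0 < δ → x ≤ ENNReal.ofReal (Real.exp δ) * y) : x ≤ y := by
  have hc : Filter.Tendsto (fun δ : ℝ => ENNReal.ofReal (Real.exp δ) * y)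
      (nhdsWithin 0 (Ioi 0)) (nhds (ENNReal.ofReal (Real.exp 0) * y)) := by
    refine ENNReal.Tendsto.mul_const ?_ (Or.inl (by simp))
    exact (ENNReal.continuous_ofReal.comp Real.continuous_exp).continuousAt.tendsto.mono_left
      nhdsWithin_le_nhds
  simp only [Real.exp_zero, ENNReal.ofReal_one, one_mul] at hc
  exact ge_of_tendsto hc (Filter.eventually_of_mem self_mem_nhdsWithin fun δ hδ => h δ hδ)

/-- The cells cover only `0 < u`, so points of nonpositive level are lost. The inequality holds for
every `ω` and needs no almost sure argument. -/
theorem tsum_hits_cell_le {Z : ι → Ω → E} {u : E → ℝ} {δ : ℝ} (hδ : 0 < δ) (S : Set E) (ω : Ω) :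
    ∑' n, hits Z (S ∩ cell u δ n) ω ≤ hits Z S ω := by
  rw [← hits_iUnion Z (fun n m hnm => (pairwise_disjoint_cell u hδ hnm).mono inter_subset_right
      inter_subset_right), iUnion_inter_cell hδ]
  exact ENNReal.tsum_le_tsum fun i => indicator_le_indicator_of_subset inter_subset_left
    (fun _ => zero_le) _

variable [MeasurableSpace Ω] [MeasurableSpace E]

/-- The void probabilities and the mean counts of the family `Z` of random points are those of a
Poisson process with intensity measure `ν`. -/
structure IsPoissonCloud (P : Measure Ω) (Z : ι → Ω → E) (ν : Measure E) : Prop where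
  measurable : ∀ i, Measurable (Z i)
  void : ∀ A, MeasurableSet A → ν A < ∞ → P (avoid Z A) = ENNReal.ofReal (Real.exp (-ν.real A))
  mean : ∀ A, MeasurableSet A → ∑' i, P (Z i ⁻¹' A) = ν A

theorem measurableSet_cell {u : E → ℝ} (hu : Measurable u) (δ : ℝ) (n : ℕ) :
    MeasurableSet (cell u δ n) :=
  (measurableSet_lt measurable_const hu).inter (measurableSet_le hu measurable_const)

theorem measurableSet_avoid [Countable ι] {Z : ι → Ω → E} (hZ : ∀ i, Measurable (Z i)) {A : Set E}
    (hA : MeasurableSet A) : MeasurableSet (avoid Z A) := by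
  have : avoid Z A = ⋂ i, (Z i ⁻¹' A)ᶜ := by ext; simp [avoid]
  rw [this]
  exact MeasurableSet.iInter fun i => (hZ i hA).compl

theorem measurable_hits [Countable ι] {Z : ι → Ω → E} (hZ : ∀ i, Measurable (Z i)) {A : Set E}
    (hA : MeasurableSet A) : Measurable (hits Z A) :=
  Measurable.tsum fun i => (measurable_one.indicator hA).comp (hZ i)

/-- The measure of the sublevel sets of `u` is their level. -/
structure IsLevel (ν : Measure E) (u : E → ℝ) : Prop where
  measurable : Measurable u
  measure_le : ∀ a, 0 ≤ a → ν {z | u z ≤ a} = ENNReal.ofReal a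

namespace IsLevel

variable {ν : Measure E} {u : E → ℝ} (hu : IsLevel ν u)
include hu

theorem measure_Ioc {a b : ℝ} (ha : 0 ≤ a) (hab : a ≤ b) :
    ν {z | a < u z ∧ u z ≤ b} = ENNReal.ofReal (b - a) := by
  have : {z | a < u z ∧ u z ≤ b} = {z | u z ≤ b} \ {z | u z ≤ a} := by
    ext z; simp [and_comm]
  have hsub : {z | u z ≤ a} ⊆ {z | u z ≤ b} := fun z hz => le_trans hz hab
  rw [this, measure_sdiff hsub
    (measurableSet_le hu.measurable measurable_const).nullMeasurableSet
    (by rw [hu.measure_le a ha]; simp), hu.measure_le a ha, hu.measure_le b (ha.trans hab),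
    ENNReal.ofReal_sub _ ha]

theorem measure_cell {δ : ℝ} (hδ : 0 < δ) (n : ℕ) : ν (cell u δ n) = ENNReal.ofReal δ := by
  have := hu.measure_Ioc (a := n * δ) (b := (n + 1) * δ) (by positivity) (by nlinarith)
  rw [cell, this]
  ring_nf

theorem measure_nonpos : ν {z | u z ≤ 0} = 0 := by simpa using hu.measure_le 0 le_rfl

theorem measure_inter_pos (D : Set E) : ν (D ∩ {z | 0 < u z}) = ν D := by
  refine measure_inter_conull ?_
  refine measure_mono_null (fun z hz => ?_) hu.measure_nonpos
  simpa using hz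

theorem sigmaFinite : SigmaFinite ν := by
  refine ⟨⟨⟨fun n : ℕ => {z | u z ≤ n}, fun _ => trivial, fun n => ?_, ?_⟩⟩⟩
  · rw [hu.measure_le n n.cast_nonneg]
    exact ENNReal.ofReal_lt_top
  · exact eq_univ_of_forall fun z => mem_iUnion.2 (exists_nat_ge (u z))

end IsLevel

namespace IsPoissonCloud

variable [Countable ι] {P : Measure Ω} [IsProbabilityMeasure P] {Z : ι → Ω → E} {ν : Measure E}
  {u : E → ℝ} (hZ : IsPoissonCloud P Z ν) (hu : IsLevel ν u)

omit [IsProbabilityMeasure P] in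
include hZ in
theorem lintegral_hits {S : Set E} (hS : MeasurableSet S) : ∫⁻ ω, hits Z S ω ∂P = ν S := by
  unfold hits
  have hm : ∀ i, AEMeasurable (fun ω => S.indicator (1 : E → ℝ≥0∞) (Z i ω)) P := fun i =>
    ((measurable_one.indicator hS).comp (hZ.measurable i)).aemeasurable
  rw [lintegral_tsum hm, ← hZ.mean S hS]
  refine tsum_congr fun i => ?_
  rw [← lintegral_indicator_one (hZ.measurable i hS)]
  rfl

include hZ in
-- With x = ν S ≤ δ one has 1 - exp(-x) ≥ x exp(-x) ≥ x exp(-δ): a set of small mass is occupied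
-- with nearly the probability given by its mean count.
theorem measure_avoid_compl {S : Set E} (hS : MeasurableSet S) {δ : ℝ}
    (hδ : ν S ≤ ENNReal.ofReal δ) :
    ENNReal.ofReal (Real.exp (-δ)) * ν S ≤ P (avoid Z S)ᶜ := by
  have hfin : ν S < ∞ := hδ.trans_lt ENNReal.ofReal_lt_top
  rw [prob_compl_eq_one_sub (measurableSet_avoid hZ.measurable hS), hZ.void S hS hfin,
    ← ENNReal.ofReal_one, ← ENNReal.ofReal_sub _ (Real.exp_pos _).le,
    ← ENNReal.ofReal_toReal hfin.ne, ← ENNReal.ofReal_mul (Real.exp_pos _).le]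
  rcases le_or_gt δ 0 with h0 | h0
  · rw [ENNReal.ofReal_of_nonpos h0, nonpos_iff_eq_zero] at hδ
    simp [hδ, Measure.real]
  refine ENNReal.ofReal_le_ofReal ?_
  have hx : ν.real S ≤ δ := ENNReal.toReal_le_of_le_ofReal h0.le hδ
  have hx0 : 0 ≤ ν.real S := measureReal_nonneg
  change Real.exp (-δ) * ν.real S ≤ 1 - Real.exp (-ν.real S)
  have h1 : Real.exp (-δ) ≤ Real.exp (-ν.real S) := Real.exp_le_exp.2 (by linarith)
  have h2 : Real.exp (-ν.real S) * (1 + ν.real S) ≤ 1 := by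
    calc _ ≤ Real.exp (-ν.real S) * Real.exp (ν.real S) := by
          gcongr; linarith [Real.add_one_le_exp (ν.real S)]
      _ = 1 := by rw [← Real.exp_add]; simp
  nlinarith [mul_le_mul_of_nonneg_right h1 hx0]

include hZ hu in
/-- The mean number of occupied cells is close to the mean number of points. -/
theorem le_tsum_measure_avoid_compl {S : Set E} (hS : MeasurableSet S) {δ : ℝ} (hδ : 0 < δ) :
    ν S ≤ ENNReal.ofReal (Real.exp δ) * ∑' n, P (avoid Z (S ∩ cell u δ n))ᶜ := by
  have hm := fun n => hS.inter (measurableSet_cell hu.measurable δ n)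
  have h1 : ν S = ∑' n, ν (S ∩ cell u δ n) := by
    rw [← hu.measure_inter_pos S, ← iUnion_inter_cell hδ, measure_iUnion _ hm]
    exact fun n m hnm => (pairwise_disjoint_cell u hδ hnm).mono inter_subset_right
      inter_subset_right
  rw [h1, ← ENNReal.tsum_mul_left]
  refine ENNReal.tsum_le_tsum fun n => ?_
  calc ν (S ∩ cell u δ n)
      = ENNReal.ofReal (Real.exp δ) * (ENNReal.ofReal (Real.exp (-δ)) * ν (S ∩ cell u δ n)) := by
        rw [← mul_assoc, ← ENNReal.ofReal_mul (Real.exp_pos _).le, ← Real.exp_add]; simp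
    _ ≤ _ := by
        gcongr
        exact hZ.measure_avoid_compl (hm n)
          ((measure_mono inter_subset_right).trans (hu.measure_cell hδ n).le)

include hZ hu in
-- The count in `S` dominates the number of occupied cells of `S`. Each occupation event is
-- independent of `F`, and on average at least exp(-δ) ν S cells are occupied.
theorem mul_le_setLIntegral_hits {F : Set Ω} {S : Set E} (hS : MeasurableSet S)
    (hind : ∀ B ⊆ S, MeasurableSet B → P (F ∩ (avoid Z B)ᶜ) = P F * P (avoid Z B)ᶜ) :
    P F * ν S ≤ ∫⁻ ω in F, hits Z S ω ∂P := by
  refine le_of_forall_le_exp_mul fun δ hδ => ?_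
  have hm := fun n => hS.inter (measurableSet_cell hu.measurable δ n)
  calc P F * ν S
      ≤ P F * (ENNReal.ofReal (Real.exp δ) * ∑' n, P (avoid Z (S ∩ cell u δ n))ᶜ) := by
        gcongr; exact hZ.le_tsum_measure_avoid_compl hu hS hδ
    _ = ENNReal.ofReal (Real.exp δ) * ∑' n, P (F ∩ (avoid Z (S ∩ cell u δ n))ᶜ) := by
        rw [mul_left_comm, ← ENNReal.tsum_mul_left]
        congr 2
        ext n
        rw [hind _ inter_subset_left (hm n)]
    _ ≤ ENNReal.ofReal (Real.exp δ) * ∑' n, ∫⁻ ω in F, hits Z (S ∩ cell u δ n) ω ∂P := by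
        gcongr with n
        have hA := (measurableSet_avoid hZ.measurable (hm n)).compl
        rw [inter_comm, ← Measure.restrict_apply hA, ← lintegral_indicator_one hA]
        refine lintegral_mono fun ω => ?_
        exact indicator_le (fun ω hω => one_le_hits hω) ω
    _ = ENNReal.ofReal (Real.exp δ) * ∫⁻ ω in F, ∑' n, hits Z (S ∩ cell u δ n) ω ∂P := by
        rw [lintegral_tsum fun n => (measurable_hits hZ.measurable (hm n)).aemeasurable]
    _ ≤ _ := by
        gcongr with ω
        exact tsum_hits_cell_le hδ S ω

omit [Countable ι] [IsProbabilityMeasure P] in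
include hZ in
theorem measure_avoid_inter {A B : Set E} (hA : MeasurableSet A) (hB : MeasurableSet B)
    (hνA : ν A < ∞) (hνB : ν B < ∞) (hAB : Disjoint A B) :
    P (avoid Z A ∩ avoid Z B) = P (avoid Z A) * P (avoid Z B) := by
  rw [← avoid_union, hZ.void _ (hA.union hB) (measure_union_lt_top hνA hνB), hZ.void _ hA hνA,
    hZ.void _ hB hνB, measureReal_union hAB hB hνA.ne hνB.ne, neg_add, Real.exp_add,
    ENNReal.ofReal_mul (Real.exp_pos _).le]

include hZ hu in
/-- The number of points in `S` is uncorrelated with the event that there is no point in `A`. -/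
theorem setLIntegral_avoid_hits {A S : Set E} (hA : MeasurableSet A) (hS : MeasurableSet S)
    (hνA : ν A < ∞) (hνS : ν S < ∞) (hAS : Disjoint A S) :
    ∫⁻ ω in avoid Z A, hits Z S ω ∂P = P (avoid Z A) * ν S := by
  have hF := measurableSet_avoid hZ.measurable hA
  have hind : ∀ B ⊆ S, MeasurableSet B →
      P (avoid Z A ∩ (avoid Z B)ᶜ) = P (avoid Z A) * P (avoid Z B)ᶜ := fun B hBS hB =>
    measure_inter_compl_eq_mul (measurableSet_avoid hZ.measurable hB)
      (hZ.measure_avoid_inter hA hB hνA ((measure_mono hBS).trans_lt hνS) (hAS.mono_right hBS))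
  -- Only lower bounds are at hand, but those for `avoid Z A` and for its complement add up to the
  -- exact total `ν S`, which is finite; so both are equalities.
  have h1 := hZ.mul_le_setLIntegral_hits hu hS hind
  have h2 := hZ.mul_le_setLIntegral_hits hu (F := (avoid Z A)ᶜ) hS fun B hBS hB => by
    rw [inter_comm, mul_comm]
    exact measure_inter_compl_eq_mul hF (by rw [inter_comm, mul_comm, hind B hBS hB])
  have h3 : ∫⁻ ω in avoid Z A, hits Z S ω ∂P + ∫⁻ ω in (avoid Z A)ᶜ, hits Z S ω ∂P = ν S := by
    rw [lintegral_add_compl _ hF, hZ.lintegral_hits hS]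
  have h4 : P (avoid Z A) * ν S + P (avoid Z A)ᶜ * ν S = ν S := by
    rw [← add_mul, prob_add_prob_compl hF, one_mul]
  refine le_antisymm ?_ h1
  have h5 : P (avoid Z A)ᶜ * ν S ≠ ∞ := ENNReal.mul_ne_top (measure_ne_top _ _) hνS.ne
  rw [← ENNReal.add_le_add_iff_right h5, h4]
  calc _ ≤ _ := by gcongr
    _ = _ := h3

end IsPoissonCloud

end Cloud
end UDN

/-! ### The law of the first point, by a sandwich on level cells. -/

namespace UDN

section First

variable {ι Ω E : Type*}

theorem hits_eq_encard (Z : ι → Ω → E) (A : Set E) (ω : Ω) :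
    hits Z A ω = ({i | Z i ω ∈ A}.encard : ℝ≥0∞) := by
  rw [← ENNReal.tsum_set_one, tsum_subtype {i | Z i ω ∈ A} fun _ => (1 : ℝ≥0∞)]
  rfl

/-- The `i`-th point of the family `Z` has the least value of `u`. -/
def IsFirst (Z : ι → Ω → E) (u : E → ℝ) (i : ι) (ω : Ω) : Prop := ∀ i', u (Z i ω) ≤ u (Z i' ω)

/-- The event that a point of the family `Z` with the least value of `u` lies in `D`. -/
def firstIn (Z : ι → Ω → E) (u : E → ℝ) (D : Set E) : Set Ω := {ω | ∃ i, IsFirst Z u i ω ∧ Z i ω ∈ D}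

theorem subset_sublevel_trans {A : Set E} {u : E → ℝ} {b c : ℝ} (hA : A ⊆ {z | u z ≤ b})
    (hbc : b ≤ c) : A ⊆ {z | u z ≤ c} := fun z hz => by
  have : u z ≤ b := hA hz
  exact this.trans hbc

variable [MeasurableSpace Ω] [MeasurableSpace E] [Countable ι]

theorem measurableSet_isFirst {Z : ι → Ω → E} {u : E → ℝ} (hZ : ∀ i, Measurable (Z i))
    (hu : Measurable u) (i : ι) : MeasurableSet {ω | IsFirst Z u i ω} := by
  simp only [IsFirst, ofPred_forall]
  exact MeasurableSet.iInter fun i' =>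
    measurableSet_le (hu.comp (hZ i)) (hu.comp (hZ i'))

theorem measurableSet_firstIn {Z : ι → Ω → E} {u : E → ℝ} (hZ : ∀ i, Measurable (Z i))
    (hu : Measurable u) {D : Set E} (hD : MeasurableSet D) : MeasurableSet (firstIn Z u D) := by
  simp only [firstIn, ofPred_exists]
  exact MeasurableSet.iUnion fun i => (measurableSet_isFirst hZ hu i).inter (hZ i hD)

section Sandwich

variable {Q : Measure Ω} {Z : ι → Ω → E} {ν : Measure E} {u : E → ℝ} (hZ : ∀ i, Measurable (Z i))
  (hu : IsLevel ν u) {κ : ℝ≥0∞} (hκ : κ ≠ ∞) {b : ℝ}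
  (hvoid : ∀ A ⊆ {z | u z ≤ b}, MeasurableSet A →
    Q (avoid Z A) = κ * ENNReal.ofReal (Real.exp (-ν.real A)))

include hZ hu hκ hvoid

/-- A difference of two void probabilities. The general `Q` and `κ` serve two uses: `P` itself with
`κ = 1`, and `P` weighted by the count in a set above level `b`, with `κ` the mass of that set. In
the second use the void formula is available only up to level `b`. -/
theorem measure_avoid_inter_avoid_compl {A C : Set E} (hA : MeasurableSet A) (hC : MeasurableSet C)
    (hAC : Disjoint A C) (hAb : A ⊆ {z | u z ≤ b}) (hCb : C ⊆ {z | u z ≤ b}) :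
    Q (avoid Z A ∩ (avoid Z C)ᶜ) =
      κ * ENNReal.ofReal (Real.exp (-ν.real A) * (1 - Real.exp (-ν.real C))) := by
  have hfin : ∀ B ⊆ {z | u z ≤ b}, ν B ≠ ∞ := fun B hB => by
    have hle := subset_sublevel_trans hB (le_max_left b 0)
    refine ne_top_of_le_ne_top ?_ (measure_mono hle)
    rw [hu.measure_le _ (le_max_right _ _)]
    exact ENNReal.ofReal_ne_top
  have h1 : Q (avoid Z A ∩ avoid Z C) + Q (avoid Z A ∩ (avoid Z C)ᶜ) = Q (avoid Z A) := by
    rw [← Set.sdiff_eq, measure_inter_add_sdiff _ (measurableSet_avoid hZ hC)]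
  have hne : κ * ENNReal.ofReal (Real.exp (-(ν.real A + ν.real C))) ≠ ∞ :=
    ENNReal.mul_ne_top hκ ENNReal.ofReal_ne_top
  rw [← avoid_union, hvoid _ hAb hA, hvoid _ (union_subset hAb hCb) (hA.union hC),
    measureReal_union hAC hC (hfin A hAb) (hfin C hCb)] at h1
  rw [← ENNReal.add_right_inj hne, h1, ← mul_add, ← ENNReal.ofReal_add (by positivity)]
  · congr 2
    rw [neg_add, Real.exp_add]
    ring
  · have : Real.exp (-ν.real C) ≤ 1 := Real.exp_le_one_iff.2 (by simp [measureReal_nonneg])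
    have := Real.exp_pos (-ν.real A)
    nlinarith

/-- If a first point lies in `C`, then `C` is occupied and no point has level at most `a`; the bound
then follows from 1 - exp(-x) ≤ x. -/
theorem measure_firstIn_le {C : Set E} (hC : MeasurableSet C) (hCb : C ⊆ {z | u z ≤ b}) {a : ℝ}
    (ha : 0 ≤ a) (hCa : C ⊆ {z | a < u z}) :
    Q (firstIn Z u C) ≤ κ * ENNReal.ofReal (Real.exp (-a) * ν.real C) := by
  rcases C.eq_empty_or_nonempty with rfl | ⟨z₀, hz₀⟩
  · simp [firstIn]
  have hab : a < b := lt_of_lt_of_le (hCa hz₀) (hCb hz₀)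
  have hmA : MeasurableSet {z | u z ≤ a} := measurableSet_le hu.measurable measurable_const
  have hd : Disjoint {z | u z ≤ a} C :=
    Set.disjoint_left.2 fun z hz hzC => by
      have h1 : u z ≤ a := hz
      have h2 : a < u z := hCa hzC
      exact absurd h1 h2.not_ge
  calc Q (firstIn Z u C) ≤ Q (avoid Z {z | u z ≤ a} ∩ (avoid Z C)ᶜ) := by
        refine measure_mono fun ω ⟨i, hi, hiC⟩ => ⟨fun i' hi' => ?_, fun h => h i hiC⟩
        exact absurd ((hi i').trans hi') (not_le.2 (hCa hiC))
    _ = _ := measure_avoid_inter_avoid_compl hZ hu hκ hvoid hmA hC hd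
        (subset_sublevel_trans subset_rfl hab.le) hCb
    _ ≤ _ := by
        have : ν.real {z | u z ≤ a} = a := by
          rw [Measure.real, hu.measure_le a ha, ENNReal.toReal_ofReal ha]
        rw [this]
        gcongr
        linarith [Real.add_one_le_exp (-ν.real C)]

/-- If `C` is occupied and the rest of a sublevel set `B` containing it is empty, the first point
lies in `C`; local finiteness provides the minimum. The bound is then exp(-ν(B \ C)) (1 - exp(-ν C))
= exp(-ν B) (exp(ν C) - 1) ≥ exp(-b') ν C. -/
theorem le_measure_firstIn (hfin : ∀ᵐ ω ∂Q, {i | u (Z i ω) ≤ b}.Finite) {C : Set E}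
    (hC : MeasurableSet C) (hCb : C ⊆ {z | u z ≤ b}) {b' : ℝ} (hb' : 0 ≤ b')
    (hCb' : C ⊆ {z | u z ≤ b'}) :
    κ * ENNReal.ofReal (Real.exp (-b') * ν.real C) ≤ Q (firstIn Z u C) := by
  -- The bound `b'`, later the upper end of a cell, may exceed `b`, beyond which `hvoid` gives no
  -- information.
  set c := min b b' with hc
  set B := {z | u z ≤ c} with hB
  have hmB : MeasurableSet B := measurableSet_le hu.measurable measurable_const
  have hBb : B ⊆ {z | u z ≤ b} := subset_sublevel_trans subset_rfl (min_le_left _ _)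
  have hBb' : B ⊆ {z | u z ≤ b'} := subset_sublevel_trans subset_rfl (min_le_right _ _)
  have hCB : C ⊆ B := fun z hz => by
    have h1 : u z ≤ b := hCb hz
    have h2 : u z ≤ b' := hCb' hz
    exact le_min h1 h2
  have hfB' : ν {z | u z ≤ b'} ≠ ∞ := by rw [hu.measure_le b' hb']; exact ENNReal.ofReal_ne_top
  have hνB : ν.real B ≤ b' := by
    refine (measureReal_mono hBb' hfB').trans ?_
    rw [Measure.real, hu.measure_le b' hb', ENNReal.toReal_ofReal hb']
  have hνBC : ν.real (B \ C) + ν.real C = ν.real B := by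
    rw [← measureReal_union disjoint_sdiff_left hC
      (ne_top_of_le_ne_top hfB' (measure_mono (sdiff_subset.trans hBb')))
      (ne_top_of_le_ne_top hfB' (measure_mono hCb')), sdiff_union_of_subset hCB]
  calc κ * ENNReal.ofReal (Real.exp (-b') * ν.real C)
      ≤ κ * ENNReal.ofReal (Real.exp (-ν.real (B \ C)) * (1 - Real.exp (-ν.real C))) := by
        gcongr κ * ENNReal.ofReal ?_
        have h1 : Real.exp (-b') ≤ Real.exp (-ν.real B) := Real.exp_le_exp.2 (by linarith)
        have h2 : Real.exp (-ν.real (B \ C)) = Real.exp (-ν.real B) * Real.exp (ν.real C) := by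
          rw [← Real.exp_add]; congr 1; linarith
        have h3 : Real.exp (-ν.real (B \ C)) * Real.exp (-ν.real C) = Real.exp (-ν.real B) := by
          rw [← Real.exp_add]; congr 1; linarith
        rw [mul_sub, h3, h2]
        have h4 := Real.add_one_le_exp (ν.real C)
        have h5 := Real.exp_pos (-ν.real B)
        nlinarith [mul_le_mul_of_nonneg_right h1 (measureReal_nonneg : 0 ≤ ν.real C)]
    _ = Q (avoid Z (B \ C) ∩ (avoid Z C)ᶜ) :=
        (measure_avoid_inter_avoid_compl hZ hu hκ hvoid (MeasurableSet.diff hmB hC) hC disjoint_sdiff_left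
          (sdiff_subset.trans hBb) hCb).symm
    _ ≤ _ := by
        refine measure_mono_ae ?_
        filter_upwards [hfin] with ω hω h
        obtain ⟨h1, h2⟩ := h
        have hsub : {i | Z i ω ∈ C} ⊆ {i | u (Z i ω) ≤ b} := fun i hi => hCb hi
        have hne : {i | Z i ω ∈ C}.Nonempty := by
          simpa [avoid, Set.Nonempty] using h2
        obtain ⟨i, hi, hmin⟩ := Set.exists_min_image _ (fun i => u (Z i ω)) (hω.subset hsub) hne
        refine ⟨i, fun i' => ?_, hi⟩
        by_cases hi' : Z i' ω ∈ C
        · exact hmin i' hi'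
        · have : Z i' ω ∉ B := fun hB' => h1 i' ⟨hB', hi'⟩
          have h3 : c < u (Z i' ω) := not_le.1 this
          have h4 : u (Z i ω) ≤ c := hCB hi
          linarith

/-- On a cell `u` varies by at most `δ`, so the bounds of the two preceding lemmas match the
integral of exp(-u) up to a factor exp(δ). Summation over the cells and δ → 0 give equality. -/
theorem measure_firstIn (hfin : ∀ᵐ ω ∂Q, {i | u (Z i ω) ≤ b}.Finite)
    (hpos : ∀ᵐ ω ∂Q, ∀ i, 0 < u (Z i ω)) {D : Set E}
    (hD : MeasurableSet D) (hDb : D ⊆ {z | u z ≤ b}) :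
    Q (firstIn Z u D) = κ * ∫⁻ z in D, ENNReal.ofReal (Real.exp (-u z)) ∂ν := by
  have hmC := fun δ n => hD.inter (measurableSet_cell hu.measurable δ n)
  have hsum : ∀ δ : ℝ, 0 < δ → Q (firstIn Z u D) = ∑' n, Q (firstIn Z u (D ∩ cell u δ n)) := by
    intro δ hδ
    rw [← measure_iUnion _ fun n => measurableSet_firstIn hZ hu.measurable (hmC δ n)]
    · refine measure_congr ?_
      filter_upwards [hpos] with ω hω
      refine propext ⟨fun ⟨i, hi, hiD⟩ => ?_, fun h => ?_⟩
      · obtain ⟨n, hn⟩ := exists_mem_cell hδ (hω i)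
        exact mem_iUnion.2 ⟨n, i, hi, hiD, hn⟩
      · obtain ⟨n, i, hi, hiD, -⟩ := mem_iUnion.1 h
        exact ⟨i, hi, hiD⟩
    -- Two first points have equal levels and therefore share a cell.
    · intro n m hnm
      refine Set.disjoint_left.2 fun ω ⟨i, hi, _, hin⟩ ⟨j, hj, _, hjm⟩ => hnm ?_
      exact cell_unique hδ (le_antisymm (hi j) (hj i)) hin hjm
  have hsum' : ∀ δ : ℝ, 0 < δ → ∫⁻ z in D, ENNReal.ofReal (Real.exp (-u z)) ∂ν =
      ∑' n, ∫⁻ z in D ∩ cell u δ n, ENNReal.ofReal (Real.exp (-u z)) ∂ν := by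
    intro δ hδ
    rw [← lintegral_iUnion (hmC δ) fun n m hnm =>
      (pairwise_disjoint_cell u hδ hnm).mono inter_subset_right inter_subset_right,
      iUnion_inter_cell hδ]
    refine setLIntegral_congr ?_
    refine (inter_ae_eq_left_of_ae_eq_univ ?_).symm
    rw [ae_eq_univ]
    refine measure_mono_null (fun z hz => ?_) hu.measure_nonpos
    simpa using hz
  have hfinC : ∀ (δ : ℝ) n, ν (D ∩ cell u δ n) ≠ ∞ := fun δ n => by
    have hle : D ∩ cell u δ n ⊆ _ := subset_sublevel_trans (inter_subset_left.trans hDb) (le_max_left b 0)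
    refine ne_top_of_le_ne_top ?_ (measure_mono hle)
    rw [hu.measure_le _ (le_max_right _ _)]
    exact ENNReal.ofReal_ne_top
  refine le_antisymm (le_of_forall_le_exp_mul fun δ hδ => ?_)
    (le_of_forall_le_exp_mul fun δ hδ => ?_)
  · rw [hsum δ hδ, hsum' δ hδ, ← ENNReal.tsum_mul_left, ← ENNReal.tsum_mul_left]
    refine ENNReal.tsum_le_tsum fun n => ?_
    refine (measure_firstIn_le hZ hu hκ hvoid (hmC δ n) (inter_subset_left.trans hDb)
      (a := n * δ) (by positivity) fun z hz => hz.2.1).trans ?_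
    rw [mul_left_comm]
    gcongr
    calc ENNReal.ofReal (Real.exp (-(n * δ)) * ν.real (D ∩ cell u δ n))
        = ENNReal.ofReal (Real.exp δ) * ∫⁻ z in D ∩ cell u δ n,
            ENNReal.ofReal (Real.exp (-((n + 1) * δ))) ∂ν := by
          rw [setLIntegral_const, ← mul_assoc, ← ENNReal.ofReal_mul (Real.exp_pos _).le,
            ← Real.exp_add, ENNReal.ofReal_mul (Real.exp_pos _).le, Measure.real,
            ENNReal.ofReal_toReal (hfinC δ n)]
          ring_nf
      _ ≤ _ := by
          gcongr 1
          refine setLIntegral_mono' (hmC δ n) fun z hz => ?_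
          exact ENNReal.ofReal_le_ofReal (Real.exp_le_exp.2 (neg_le_neg hz.2.2))
  · rw [hsum δ hδ, hsum' δ hδ, ← ENNReal.tsum_mul_left, ← ENNReal.tsum_mul_left]
    refine ENNReal.tsum_le_tsum fun n => ?_
    refine le_trans ?_ (mul_le_mul_right (le_measure_firstIn hZ hu hκ hvoid hfin (hmC δ n)
      (inter_subset_left.trans hDb) (b' := (n + 1) * δ) (by positivity) fun z hz => hz.2.2) _)
    rw [mul_left_comm]
    gcongr
    calc ∫⁻ z in D ∩ cell u δ n, ENNReal.ofReal (Real.exp (-u z)) ∂ν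
        ≤ ∫⁻ z in D ∩ cell u δ n, ENNReal.ofReal (Real.exp (-(n * δ))) ∂ν := by
          refine setLIntegral_mono' (hmC δ n) fun z hz => ?_
          exact ENNReal.ofReal_le_ofReal (Real.exp_le_exp.2 (neg_le_neg hz.2.1.le))
      _ = _ := by
          rw [setLIntegral_const, ENNReal.ofReal_mul (Real.exp_pos _).le, Measure.real,
            ENNReal.ofReal_toReal (hfinC δ n), ← mul_assoc,
            ← ENNReal.ofReal_mul (Real.exp_pos _).le, ← Real.exp_add]
          ring_nf

end Sandwich
end First
end UDN

/-! ### Uniqueness of the first point, and its joint law with the other points. -/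

namespace UDN

namespace IsPoissonCloud

variable {ι Ω E : Type*} [MeasurableSpace Ω] [MeasurableSpace E] [Countable ι]
  {P : Measure Ω} [IsProbabilityMeasure P] {Z : ι → Ω → E} {ν : Measure E} {u : E → ℝ}
  (hZ : IsPoissonCloud P Z ν) (hu : IsLevel ν u)

omit [IsProbabilityMeasure P] in
include hZ in
/-- Almost surely no point lies in a null set. -/
theorem ae_notMem_of_null {A : Set E} (hA : MeasurableSet A) (h0 : ν A = 0) :
    ∀ᵐ ω ∂P, ∀ i, Z i ω ∉ A := by
  rw [ae_all_iff]
  intro i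
  have := hZ.mean A hA
  rw [h0, ENNReal.tsum_eq_zero] at this
  exact measure_eq_zero_iff_ae_notMem.1 (this i)

omit [IsProbabilityMeasure P] in
include hZ hu in
theorem ae_level_pos : ∀ᵐ ω ∂P, ∀ i, 0 < u (Z i ω) := by
  filter_upwards [hZ.ae_notMem_of_null (measurableSet_le hu.measurable measurable_const)
    hu.measure_nonpos] with ω hω i
  simpa using hω i

omit [IsProbabilityMeasure P] in
include hZ hu in
theorem ae_finite_level_le (b : ℝ) : ∀ᵐ ω ∂P, {i | u (Z i ω) ≤ b}.Finite := by
  have hm : MeasurableSet {z | u z ≤ max b 0} := measurableSet_le hu.measurable measurable_const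
  have hfin : ∫⁻ ω, hits Z {z | u z ≤ max b 0} ω ∂P ≠ ∞ := by
    rw [hZ.lintegral_hits hm, hu.measure_le _ (le_max_right _ _)]
    exact ENNReal.ofReal_ne_top
  filter_upwards [ae_lt_top (measurable_hits hZ.measurable hm) hfin] with ω hω
  rw [hits_eq_encard] at hω
  have h1 : {i | Z i ω ∈ {z | u z ≤ max b 0}}.Finite := by
    rw [← Set.encard_lt_top_iff]
    exact_mod_cast hω
  refine h1.subset fun i (hi : u (Z i ω) ≤ b) => ?_
  exact hi.trans (le_max_left _ _)

omit [Countable ι] [IsProbabilityMeasure P] in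
include hZ hu in
-- The void probabilities exp(-n) of the sublevel sets tend to 0, so there is at least one point.
theorem ae_exists_level_le : ∀ᵐ ω ∂P, ∃ i, ∃ n : ℕ, u (Z i ω) ≤ n := by
  have h : P {ω | ¬ ∃ i, ∃ n : ℕ, u (Z i ω) ≤ n} ≤ 0 := by
    have hlim : Filter.Tendsto (fun n : ℕ => ENNReal.ofReal (Real.exp (-(n : ℝ)))) Filter.atTop
        (nhds 0) := by
      rw [← ENNReal.ofReal_zero]
      refine (ENNReal.continuous_ofReal.tendsto 0).comp ?_
      exact Real.tendsto_exp_neg_atTop_nhds_zero.comp tendsto_natCast_atTop_atTop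
    refine ge_of_tendsto' hlim fun n => ?_
    have hν : ν {z | u z ≤ n} = ENNReal.ofReal n := hu.measure_le n (by positivity)
    have := hZ.void {z | u z ≤ n} (measurableSet_le hu.measurable measurable_const)
      (by rw [hν]; exact ENNReal.ofReal_lt_top)
    rw [Measure.real, hν, ENNReal.toReal_ofReal (by positivity)] at this
    rw [← this]
    refine measure_mono fun ω hω i hi => hω ⟨i, n, hi⟩
  exact ae_iff.2 (le_antisymm h zero_le)

include hZ hu in
/-- Almost surely the points have different levels. -/
theorem ae_level_ne : ∀ᵐ ω ∂P, ∀ i i', i ≠ i' → u (Z i ω) ≠ u (Z i' ω) := by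
  -- Tied points share a cell in every grid, so on a tie the count exceeds the number of occupied
  -- cells by at least one. The means of these two numbers agree up to a factor exp(δ) for every
  -- `δ`, which forces a tie to have probability 0. The bound `T` keeps the mean count finite, so
  -- that it can be cancelled.
  have htie : ∀ T : ℕ, P {ω | ∃ i i', i ≠ i' ∧ u (Z i ω) = u (Z i' ω) ∧
      0 < u (Z i ω) ∧ u (Z i ω) ≤ T} = 0 := by
    intro T
    set tie := {ω | ∃ i i', i ≠ i' ∧ u (Z i ω) = u (Z i' ω) ∧ 0 < u (Z i ω) ∧ u (Z i ω) ≤ T}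
    set S := {z | u z ≤ T}
    have hS : MeasurableSet S := measurableSet_le hu.measurable measurable_const
    have hνS : ν S ≠ ∞ := by
      rw [hu.measure_le T (by positivity)]; exact ENNReal.ofReal_ne_top
    have hmt : MeasurableSet tie := by
      have : tie = ⋃ i, ⋃ i', ⋃ (_ : i ≠ i'), ({ω | u (Z i ω) = u (Z i' ω)} ∩
          ({ω | 0 < u (Z i ω)} ∩ {ω | u (Z i ω) ≤ T})) := by
        ext ω; simp [tie, and_left_comm]
      rw [this]
      have hm := fun i => hu.measurable.comp (hZ.measurable i)
      exact MeasurableSet.iUnion fun i => MeasurableSet.iUnion fun i' => MeasurableSet.iUnion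
        fun _ => (measurableSet_eq_fun (hm i) (hm i')).inter
          ((measurableSet_lt measurable_const (hm i)).inter
            (measurableSet_le (hm i) measurable_const))
    have key : ν S + P tie ≤ ν S := by
      refine le_of_forall_le_exp_mul fun δ hδ => ?_
      have hm := fun n => hS.inter (measurableSet_cell hu.measurable δ n)
      have h1 := hZ.le_tsum_measure_avoid_compl hu hS hδ
      have h2 : ∑' n, P (avoid Z (S ∩ cell u δ n))ᶜ + P tie ≤ ν S := by
        have hmA := fun n => (measurableSet_avoid hZ.measurable (hm n)).compl
        rw [← hZ.lintegral_hits hS, ← lintegral_indicator_one hmt]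
        simp_rw [← fun n => lintegral_indicator_one (μ := P) (hmA n)]
        rw [← lintegral_tsum fun n => (measurable_one.indicator (hmA n)).aemeasurable,
          ← lintegral_add_right _ (measurable_one.indicator hmt)]
        refine lintegral_mono fun ω => ?_
        refine le_trans ?_ (tsum_hits_cell_le (Z := Z) (u := u) hδ S ω)
        have hone : ∀ n, (avoid Z (S ∩ cell u δ n))ᶜ.indicator 1 ω ≤ hits Z (S ∩ cell u δ n) ω :=
          fun n => indicator_le (fun ω hω => one_le_hits hω) ω
        by_cases ht : ω ∈ tie
        · obtain ⟨i, i', hne, heq, h0, hT⟩ := ht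
          obtain ⟨n, hn⟩ := exists_mem_cell hδ h0
          have hi : Z i ω ∈ S ∩ cell u δ n := ⟨hT, hn⟩
          have hi' : Z i' ω ∈ S ∩ cell u δ n := by
            refine ⟨?_, ?_⟩
            · change u (Z i' ω) ≤ T
              rwa [← heq]
            · simpa [cell, heq] using hn
          have htwo := two_le_hits hne hi hi'
          rw [indicator_of_mem (show ω ∈ tie from ⟨i, i', hne, heq, h0, hT⟩), Pi.one_apply,
            ENNReal.tsum_eq_add_tsum_ite n, ENNReal.tsum_eq_add_tsum_ite (f := fun n =>
              hits Z (S ∩ cell u δ n) ω) n, add_right_comm]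
          gcongr with m
          · refine le_trans ?_ htwo
            rw [← one_add_one_eq_two]
            gcongr
            exact indicator_le_self' (fun _ _ => zero_le) ω
          · split_ifs
            · exact le_rfl
            · exact hone m
        · rw [indicator_of_notMem ht, add_zero]
          exact ENNReal.tsum_le_tsum hone
      calc ν S + P tie ≤ ENNReal.ofReal (Real.exp δ) * ∑' n, P (avoid Z (S ∩ cell u δ n))ᶜ +
            ENNReal.ofReal (Real.exp δ) * P tie := by
            gcongr
            refine le_mul_of_one_le_left zero_le ?_
            rw [← ENNReal.ofReal_one]
            exact ENNReal.ofReal_le_ofReal (Real.one_le_exp hδ.le)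
        _ ≤ _ := by
            rw [← mul_add]
            gcongr
    have : ν S + P tie ≤ ν S + 0 := by simpa using key
    exact le_antisymm ((ENNReal.add_le_add_iff_left hνS).1 this) zero_le
  have h0 := ae_all_iff.2 fun T => measure_eq_zero_iff_ae_notMem.1 (htie T)
  filter_upwards [h0, hZ.ae_level_pos hu] with ω hω hpos i i' hne heq
  obtain ⟨T, hT⟩ := exists_nat_ge (u (Z i ω))
  exact hω T ⟨i, i', hne, heq, hpos i, hT⟩

include hZ hu in
/-- Almost surely one point has a smaller level than all others. -/
theorem ae_exists_first : ∀ᵐ ω ∂P, ∃ i, ∀ i', i' ≠ i → u (Z i ω) < u (Z i' ω) := by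
  have hfin := ae_all_iff.2 fun n : ℕ => hZ.ae_finite_level_le hu (n : ℝ)
  filter_upwards [hfin, hZ.ae_exists_level_le hu, hZ.ae_level_ne hu] with ω h1 ⟨j, n, hj⟩ h3
  obtain ⟨i, hi, hmin⟩ := Set.exists_min_image _ (fun i => u (Z i ω)) (h1 n) ⟨j, hj⟩
  refine ⟨i, fun i' hne => lt_of_le_of_ne ?_ (h3 i i' hne.symm)⟩
  by_cases hi' : u (Z i' ω) ≤ n
  · exact hmin i' hi'
  · have hi2 : u (Z i ω) ≤ n := hi
    exact hi2.trans (not_le.1 hi').le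

omit [IsProbabilityMeasure P] in
include hZ hu in
/-- The law of the first point, on a bounded range of levels. -/
theorem measure_firstIn_of_le {b : ℝ} {D : Set E} (hD : MeasurableSet D)
    (hDb : D ⊆ {z | u z ≤ b}) :
    P (firstIn Z u D) = ∫⁻ z in D, ENNReal.ofReal (Real.exp (-u z)) ∂ν := by
  have := measure_firstIn (Q := P) hZ.measurable hu (κ := 1) ENNReal.one_ne_top (b := b)
    (fun A hA hmA => by
      rw [hZ.void A hmA, one_mul]
      refine (measure_mono (subset_sublevel_trans hA (le_max_left b 0))).trans_lt ?_
      rw [hu.measure_le _ (le_max_right _ _)]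
      exact ENNReal.ofReal_lt_top) (hZ.ae_finite_level_le hu b) (hZ.ae_level_pos hu) hD hDb
  rwa [one_mul] at this

omit [IsProbabilityMeasure P] in
include hZ hu in
/-- The law of the first point. -/
theorem measure_firstIn_eq {D : Set E} (hD : MeasurableSet D) :
    P (firstIn Z u D) = ∫⁻ z in D, ENNReal.ofReal (Real.exp (-u z)) ∂ν := by
  have hmono : Monotone fun n : ℕ => D ∩ {z | u z ≤ n} := fun n m hnm z hz =>
    ⟨hz.1, le_trans (show u z ≤ n from hz.2) (Nat.cast_le.2 hnm)⟩
  have hU : D = ⋃ n : ℕ, D ∩ {z | u z ≤ n} := by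
    ext z
    simp only [mem_iUnion, mem_inter_iff, mem_ofPred_eq]
    exact ⟨fun h => (exists_nat_ge (u z)).imp fun n hn => ⟨h, hn⟩, fun ⟨n, h, _⟩ => h⟩
  have hF : firstIn Z u D = ⋃ n : ℕ, firstIn Z u (D ∩ {z | u z ≤ n}) := by
    ext ω
    simp only [firstIn, mem_iUnion, mem_ofPred_eq, mem_inter_iff]
    exact ⟨fun ⟨i, hi, h⟩ => (exists_nat_ge (u (Z i ω))).imp fun n hn => ⟨i, hi, h, hn⟩,
      fun ⟨n, i, hi, h, _⟩ => ⟨i, hi, h⟩⟩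
  have hm : ∀ n : ℕ, MeasurableSet (D ∩ {z | u z ≤ n}) := fun n =>
    hD.inter (measurableSet_le hu.measurable measurable_const)
  have hmonoF : Monotone fun n : ℕ => firstIn Z u (D ∩ {z | u z ≤ n}) :=
    fun n m hnm ω ⟨i, hi, h⟩ => ⟨i, hi, hmono hnm h⟩
  rw [hF, hmonoF.measure_iUnion]
  conv_rhs => rw [hU, setLIntegral_iUnion_of_directed _ (directed_of_isDirected_le hmono)]
  exact iSup_congr fun n => hZ.measure_firstIn_of_le hu (hm n) inter_subset_right

include hZ hu in
/-- The law of the first point, weighted with the number of points in a set of larger levels. -/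
theorem setLIntegral_firstIn_hits {b b' : ℝ} {D S : Set E} (hD : MeasurableSet D)
    (hS : MeasurableSet S) (hDb : D ⊆ {z | u z ≤ b}) (hSb : S ⊆ {z | b < u z})
    (hSb' : S ⊆ {z | u z ≤ b'}) :
    ∫⁻ ω in firstIn Z u D, hits Z S ω ∂P =
      (∫⁻ z in D, ENNReal.ofReal (Real.exp (-u z)) ∂ν) * ν S := by
  have hlt : ∀ {A : Set E} {c : ℝ}, A ⊆ {z | u z ≤ c} → ν A < ∞ := fun {A c} hA => by
    refine (measure_mono (subset_sublevel_trans hA (le_max_left c 0))).trans_lt ?_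
    rw [hu.measure_le _ (le_max_right _ _)]
    exact ENNReal.ofReal_lt_top
  have hac : P.withDensity (hits Z S) ≪ P := withDensity_absolutelyContinuous _ _
  -- Change of measure: emptiness of a set below level `b` is uncorrelated with the count in `S`, so
  -- weighting by that count multiplies these void probabilities by the constant `ν S`, and the law
  -- of the first point scales alike.
  have := measure_firstIn (Q := P.withDensity (hits Z S)) hZ.measurable hu (κ := ν S)
    (hlt hSb').ne (b := b) (fun A hA hmA => by
      rw [withDensity_apply _ (measurableSet_avoid hZ.measurable hmA),
        hZ.setLIntegral_avoid_hits hu hmA hS (hlt hA) (hlt hSb'), hZ.void A hmA (hlt hA), mul_comm]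
      refine Set.disjoint_left.2 fun z hz hz' => ?_
      have h1 : u z ≤ b := hA hz
      have h2 : b < u z := hSb hz'
      exact absurd h1 h2.not_ge) (hac.ae_le (hZ.ae_finite_level_le hu b))
    (hac.ae_le (hZ.ae_level_pos hu)) hD hDb
  rw [← withDensity_apply _ (measurableSet_firstIn hZ.measurable hu.measurable hD), this, mul_comm]

include hZ hu in
/-- The joint law of the first point and the other points. -/
theorem tsum_measure_isFirst_pair {T : Set (E × E)} (hT : MeasurableSet T) :
    ∑' i, ∑' i', P {ω | IsFirst Z u i ω ∧ u (Z i ω) < u (Z i' ω) ∧ (Z i ω, Z i' ω) ∈ T} =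
      ∫⁻ z, ENNReal.ofReal (Real.exp (-u z)) * ν {z' | u z < u z' ∧ (z, z') ∈ T} ∂ν := by
  have := hu.sigmaFinite
  set w : E → ℝ≥0∞ := fun z => ENNReal.ofReal (Real.exp (-u z)) with hw
  have hwm : Measurable w := (Real.measurable_exp.comp hu.measurable.neg).ennreal_ofReal
  have hmF := measurableSet_isFirst hZ.measurable hu.measurable
  have hmZ : ∀ p : ι × ι, Measurable fun ω => (Z p.1 ω, Z p.2 ω) := fun p =>
    (hZ.measurable p.1).prodMk (hZ.measurable p.2)
  -- The intensity of pairs (first point, arbitrary point). It is to be identified with the product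
  -- measure on the pairs of increasing level.
  set R : Measure (E × E) := Measure.sum fun p : ι × ι =>
    (P.restrict {ω | IsFirst Z u p.1 ω}).map fun ω => (Z p.1 ω, Z p.2 ω) with hR
  have hRapp : ∀ A, MeasurableSet A →
      R A = ∑' i, ∑' i', P ((fun ω => (Z i ω, Z i' ω)) ⁻¹' A ∩ {ω | IsFirst Z u i ω}) := by
    intro A hA
    rw [hR, Measure.sum_apply _ hA, ENNReal.tsum_prod']
    refine tsum_congr fun i => tsum_congr fun i' => ?_
    rw [Measure.map_apply (hmZ (i, i')) hA, Measure.restrict_apply (hmZ (i, i') hA)]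
  -- A rational level `q.1` separates the two coordinates, and `q.2` bounds the second one, as
  -- `setLIntegral_firstIn_hits` requires. These countably many rectangles overlap, which is
  -- harmless: measures that agree on each of them agree on the union.
  set W : ℚ × ℚ → Set (E × E) := fun q => {z | u z ≤ q.1} ×ˢ {z | q.1 < u z ∧ u z ≤ q.2} with hW
  have hmle : ∀ b : ℝ, MeasurableSet {z | u z ≤ b} := fun b =>
    measurableSet_le hu.measurable measurable_const
  have hmIoc : ∀ b b' : ℝ, MeasurableSet {z | b < u z ∧ u z ≤ b'} := fun b b' =>
    (measurableSet_lt measurable_const hu.measurable).inter (hmle b')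
  have hWU : ⋃ q, W q = {p | u p.1 < u p.2} := by
    ext ⟨z, z'⟩
    simp only [mem_iUnion, hW, mem_prod, mem_ofPred_eq]
    constructor
    · rintro ⟨q, h1, h2, -⟩
      exact h1.trans_lt h2
    · intro h
      obtain ⟨b, hb1, hb2⟩ := exists_rat_btwn h
      obtain ⟨b', hb', -⟩ := exists_rat_btwn (lt_add_one (u z'))
      exact ⟨(b, b'), hb1.le, hb2, hb'.le⟩
  have hrect : ∀ q, R.restrict (W q) = ((ν.withDensity w).prod ν).restrict (W q) := by
    intro q
    rw [hW, ← Measure.prod_restrict]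
    symm
    refine Measure.prod_eq fun s t hs ht => ?_
    have hmD := hs.inter (hmle q.1)
    have hmS := ht.inter (hmIoc q.1 q.2)
    rw [Measure.restrict_apply (hs.prod ht), prod_inter_prod, Measure.restrict_apply hs,
      Measure.restrict_apply ht, withDensity_apply _ hmD, ← hZ.setLIntegral_firstIn_hits hu hmD hmS
        inter_subset_right (fun z hz => hz.2.1) (fun z hz => hz.2.2), hRapp _ (hmD.prod hmS),
      ← lintegral_indicator (measurableSet_firstIn hZ.measurable hu.measurable hmD)]
    set D := s ∩ {z | u z ≤ q.1}
    set S := t ∩ {z | q.1 < u z ∧ u z ≤ q.2}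
    have hm2 : ∀ i i', MeasurableSet ((fun ω => (Z i ω, Z i' ω)) ⁻¹' (D ×ˢ S) ∩
        {ω | IsFirst Z u i ω}) := fun i i' => (hmZ (i, i') (hmD.prod hmS)).inter (hmF i)
    simp_rw [← fun i i' => lintegral_indicator_one (μ := P) (hm2 i i')]
    simp_rw [← fun i => lintegral_tsum (μ := P) fun i' =>
      (measurable_one.indicator (hm2 i i') : Measurable _).aemeasurable]
    rw [← lintegral_tsum fun i => (Measurable.tsum fun i' =>
      measurable_one.indicator (hm2 i i')).aemeasurable]
    refine lintegral_congr_ae ?_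
    -- With a single first point `m` only row `m` of the double sum survives; it is the count in `S`
    -- if that point lies in `D`, and 0 otherwise.
    filter_upwards [hZ.ae_exists_first hu] with ω ⟨m, hm⟩
    have hfirst : ∀ i, IsFirst Z u i ω ↔ i = m := by
      refine fun i => ⟨fun h => ?_, ?_⟩
      · by_contra hne
        exact absurd (h m) (hm i hne).not_ge
      · rintro rfl i'
        rcases eq_or_ne i' i with rfl | hne
        · exact le_rfl
        · exact (hm i' hne).le
    rw [tsum_eq_single m]
    · by_cases hmD' : Z m ω ∈ D
      · rw [indicator_of_mem (show ω ∈ firstIn Z u D from ⟨m, (hfirst m).2 rfl, hmD'⟩)]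
        refine tsum_congr fun i' => ?_
        by_cases hS' : Z i' ω ∈ S <;> simp [hmD', hS', hfirst]
      · rw [indicator_of_notMem]
        · simp [hmD']
        · rintro ⟨i, hi, hiD⟩
          rw [(hfirst i).1 hi] at hiD
          exact hmD' hiD
    · intro i hi
      simp [hfirst, hi]
  have hall := Measure.restrict_iUnion_congr.2 hrect
  rw [hWU] at hall
  have hmW : MeasurableSet {p : E × E | u p.1 < u p.2} :=
    measurableSet_lt (hu.measurable.comp measurable_fst) (hu.measurable.comp measurable_snd)
  have h1 : R (T ∩ {p | u p.1 < u p.2}) = ((ν.withDensity w).prod ν) (T ∩ {p | u p.1 < u p.2}) := by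
    rw [← Measure.restrict_apply hT, hall, Measure.restrict_apply hT]
  rw [hRapp _ (hT.inter hmW), Measure.prod_apply (hT.inter hmW),
    lintegral_withDensity_eq_lintegral_mul _ hwm
      (measurable_measure_prodMk_left (hT.inter hmW))] at h1
  refine Eq.trans (tsum_congr fun i => tsum_congr fun i' => congrArg P ?_)
    (h1.trans (lintegral_congr fun z => ?_))
  · ext ω
    simp only [mem_ofPred_eq, mem_inter_iff, mem_preimage]
    tauto
  · rw [Pi.mul_apply]
    congr 2
    ext z'
    simp [and_comm]

end IsPoissonCloud
end UDN

/-! ### Homogeneous Poisson processes: mean measure and generating functional. -/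

namespace UDN

/-- The term at 0 vanishes; after a shift of the index, the factor n cancels against n! and leaves m
times the Poisson weights. -/
theorem hasSum_mul_poisson (m : ℝ≥0) :
    HasSum (fun n : ℕ => (n : ℝ) * (Real.exp (-m) * m ^ n / n.factorial)) m := by
  rw [← hasSum_nat_add_iff' 1]
  have := (hasSum_one_poissonMeasure m).mul_left (m : ℝ)
  simp only [Finset.range_one, Finset.sum_singleton, Nat.cast_zero, zero_mul, sub_zero]
  rw [mul_one] at this
  refine this.congr_fun fun n => ?_
  rw [Nat.factorial_succ, pow_succ]
  push_cast
  field_simp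

theorem hasSum_pow_mul_poisson (m : ℝ≥0) (w : ℝ) :
    HasSum (fun n : ℕ => w ^ n * (Real.exp (-m) * m ^ n / n.factorial))
      (Real.exp (-(m * (1 - w)))) := by
  have := (NormedSpace.expSeries_div_hasSum_exp (w * m : ℝ)).mul_left (Real.exp (-m))
  rw [← Real.exp_eq_exp_ℝ, ← Real.exp_add] at this
  rw [show -(m * (1 - w) : ℝ) = -m + w * m by ring]
  refine this.congr_fun fun n => ?_
  rw [mul_pow]
  ring

/-- Telescoping, one factor at a time. No constant depends on the number of factors, which makes the
approximation of the generating functional uniform. -/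
theorem abs_prod_sub_prod_le {ι : Type*} (s : Finset ι) (a b : ι → ℝ)
    (ha : ∀ i, 0 ≤ a i ∧ a i ≤ 1) (hb : ∀ i, 0 ≤ b i ∧ b i ≤ 1) :
    |∏ i ∈ s, a i - ∏ i ∈ s, b i| ≤ ∑ i ∈ s, |a i - b i| := by
  classical
  induction s using Finset.induction_on with
  | empty => simp
  | insert i s hi ih =>
    rw [Finset.prod_insert hi, Finset.prod_insert hi, Finset.sum_insert hi]
    set A := ∏ i ∈ s, a i
    set B := ∏ i ∈ s, b i
    have hA0 : 0 ≤ A := Finset.prod_nonneg fun i _ => (ha i).1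
    have hA1 : A ≤ 1 := Finset.prod_le_one (fun i _ => (ha i).1) fun i _ => (ha i).2
    calc |a i * A - b i * B| = |(a i - b i) * A + b i * (A - B)| := by ring_nf
      _ ≤ |a i - b i| * A + b i * |A - B| := by
        refine (abs_add_le _ _).trans ?_
        rw [abs_mul, abs_mul, abs_of_nonneg hA0, abs_of_nonneg (hb i).1]
      _ ≤ |a i - b i| * 1 + 1 * |A - B| := by
        gcongr
        exact (hb i).2
      _ ≤ _ := by rw [mul_one, one_mul]; gcongr

/-- The product is constant once `n` exceeds all indices of points in `B`. -/
theorem tendsto_prod_range {Ω : Type*} {Y : ℕ → Ω → Plane} {B : Set Plane} {ω : Ω} (h : {i | Y i ω ∈ B}.Finite) (c : ℝ) :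
    Filter.Tendsto (fun n => ∏ i ∈ Finset.range n, (1 - B.indicator (fun _ => c) (Y i ω)))
      Filter.atTop (nhds ((1 - c) ^ (count Y B ω).toNat)) := by
  classical
  refine tendsto_const_nhds.congr' ?_
  obtain ⟨N, hN⟩ := h.toFinset.exists_nat_subset_range
  filter_upwards [Filter.eventually_ge_atTop N] with n hn
  have hsub : h.toFinset ⊆ Finset.range n := hN.trans (Finset.range_subset_range.2 hn)
  rw [← Finset.prod_subset hsub]
  · rw [Finset.prod_congr rfl fun i hi => by
      rw [indicator_of_mem (show Y i ω ∈ B by simpa using hi)], Finset.prod_const]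
    congr 1
    rw [count, h.encard_eq_coe_toFinset_card, ENat.toNat_natCast]
  · intro i _ hi
    rw [indicator_of_notMem (by simpa using hi), sub_zero]

namespace IsHPPP

variable {Ω : Type*} [MeasurableSpace Ω] {P : Measure Ω} [IsProbabilityMeasure P]
  {Y : ℕ → Ω → Plane} {lam : ℝ} (hY : IsHPPP P Y lam)

omit [IsProbabilityMeasure P] in
include hY in
theorem measurable_count {B : Set Plane} (hB : MeasurableSet B) : Measurable (count Y B) := by
  refine measurable_to_countable' fun n => ?_
  have : count Y B ⁻¹' {n} = hits Y B ⁻¹' {(n : ℝ≥0∞)} := by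
    ext ω
    simp [hits_eq_encard, count]
  rw [this]
  exact measurable_hits hY.measurable hB (measurableSet_singleton _)

include hY in
/-- The law of the count of a bounded set. -/
theorem map_count {B : Set Plane} (hB : MeasurableSet B) (hvol : volume B < ∞) :
    P.map (count Y B) = (poissonMeasure (Real.toNNReal (lam * volume.real B))).map
      (Nat.cast : ℕ → ℕ∞) := by
  have hm := hY.measurable_count hB
  set μ := poissonMeasure (Real.toNNReal (lam * volume.real B))
  have hc : Measurable (Nat.cast : ℕ → ℕ∞) := measurable_of_countable _
  have h1 : ∀ n : ℕ, P.map (count Y B) {(n : ℕ∞)} = μ.map (Nat.cast : ℕ → ℕ∞) {(n : ℕ∞)} := by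
    intro n
    rw [Measure.map_apply hm (measurableSet_singleton _),
      Measure.map_apply hc (measurableSet_singleton _)]
    refine (hY.poisson B hB hvol n).trans ?_
    congr 1
    ext k
    simp
  have hp1 : IsProbabilityMeasure (P.map (count Y B)) := Measure.isProbabilityMeasure_map hm.aemeasurable
  have hp2 : IsProbabilityMeasure (μ.map (Nat.cast : ℕ → ℕ∞)) :=
    Measure.isProbabilityMeasure_map hc.aemeasurable
  -- `IsHPPP` prescribes the probabilities of finite counts only. The mass at `⊤` is then
  -- determined, because both laws have total mass 1.
  have hr : ∀ ρ : Measure ℕ∞, ρ {(⊤ : ℕ∞)}ᶜ = ∑' n : ℕ, ρ {(n : ℕ∞)} := by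
    intro ρ
    have : ({(⊤ : ℕ∞)}ᶜ : Set ℕ∞) = ⋃ n : ℕ, {(n : ℕ∞)} := by
      ext k
      simp only [mem_compl_iff, mem_singleton_iff, ENat.ne_top_iff_exists, mem_iUnion, eq_comm]
    rw [this, measure_iUnion _ fun n => measurableSet_singleton _]
    intro n m hnm
    simpa using hnm
  refine Measure.ext_of_singleton fun k => ?_
  induction k using ENat.recTopCoe with
  | top =>
    have h3 : P.map (count Y B) {(⊤ : ℕ∞)}ᶜ = μ.map (Nat.cast : ℕ → ℕ∞) {(⊤ : ℕ∞)}ᶜ := by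
      rw [hr, hr]
      exact tsum_congr h1
    rw [← compl_compl {(⊤ : ℕ∞)}, prob_compl_eq_one_sub (measurableSet_singleton _).compl,
      prob_compl_eq_one_sub (measurableSet_singleton _).compl, h3]
  | coe n => exact h1 n

include hY in
theorem lintegral_hits_eq {B : Set Plane} (hB : MeasurableSet B) (hvol : volume B < ∞) :
    ∫⁻ ω, hits Y B ω ∂P = ENNReal.ofReal lam * volume B := by
  have hc : Measurable (Nat.cast : ℕ → ℕ∞) := measurable_of_countable _
  have h1 : ∫⁻ ω, hits Y B ω ∂P = ∫⁻ k, (k : ℝ≥0∞) ∂(P.map (count Y B)) := by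
    rw [lintegral_map (measurable_of_countable _) (hY.measurable_count hB)]
    exact lintegral_congr fun ω => hits_eq_encard Y B ω
  rw [h1, hY.map_count hB hvol, lintegral_map (measurable_of_countable _) hc,
    lintegral_countable']
  have h2 := hasSum_mul_poisson (Real.toNNReal (lam * volume.real B))
  have h3 : ∀ n : ℕ, (((n : ℕ∞) : ℝ≥0∞)) *
      poissonMeasure (Real.toNNReal (lam * volume.real B)) {n} =
      ENNReal.ofReal ((n : ℝ) * (Real.exp (-(Real.toNNReal (lam * volume.real B))) *
        (Real.toNNReal (lam * volume.real B)) ^ n / n.factorial)) := by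
    intro n
    rw [poissonMeasure_singleton, ENNReal.ofReal_mul n.cast_nonneg]
    simp
  simp_rw [h3]
  rw [← ENNReal.ofReal_tsum_of_nonneg (fun n => by positivity) h2.summable, h2.tsum_eq,
    ENNReal.ofReal_coe_nnreal]
  change ENNReal.ofReal (lam * volume.real B) = _
  rw [ENNReal.ofReal_mul' measureReal_nonneg, Measure.real, ENNReal.ofReal_toReal hvol.ne]

include hY in
/-- The intensity measure. -/
theorem sum_map : Measure.sum (fun i => P.map (Y i)) = ENNReal.ofReal lam • volume := by
  ext B hB
  have hfin : ∀ A, MeasurableSet A → volume A < ∞ →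
      Measure.sum (fun i => P.map (Y i)) A = ENNReal.ofReal lam * volume A := by
    intro A hA hvol
    rw [Measure.sum_apply _ hA, ← hY.lintegral_hits_eq hA hvol]
    unfold hits
    have hm : ∀ i, AEMeasurable (fun ω => A.indicator (1 : Plane → ℝ≥0∞) (Y i ω)) P := fun i =>
      ((measurable_one.indicator hA).comp (hY.measurable i)).aemeasurable
    rw [lintegral_tsum hm]
    refine tsum_congr fun i => ?_
    rw [Measure.map_apply (hY.measurable i) hA, ← lintegral_indicator_one (hY.measurable i hA)]
    rfl
  have hU : B = ⋃ n, B ∩ spanningSets (volume : Measure Plane) n := by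
    rw [← inter_iUnion, iUnion_spanningSets, inter_univ]
  have hmono : Monotone fun n => B ∩ spanningSets (volume : Measure Plane) n := fun n m hnm =>
    inter_subset_inter_right _ (monotone_spanningSets _ hnm)
  rw [hU, hmono.measure_iUnion, hmono.measure_iUnion]
  refine iSup_congr fun n => ?_
  rw [hfin _ (hB.inter (measurableSet_spanningSets _ _))
    ((measure_mono inter_subset_right).trans_lt (measure_spanningSets_lt_top _ _))]
  rfl

include hY in
/-- Campbell's formula. -/
theorem tsum_lintegral {f : Plane → ℝ≥0∞} (hf : Measurable f) :
    ∑' i, ∫⁻ ω, f (Y i ω) ∂P = ENNReal.ofReal lam * ∫⁻ y, f y := by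
  rw [← smul_eq_mul, ← lintegral_smul_measure, ← hY.sum_map, lintegral_sum_measure]
  exact tsum_congr fun i => (lintegral_map hf (hY.measurable i)).symm

include hY in
theorem ae_finite {B : Set Plane} (hB : MeasurableSet B) (hvol : volume B < ∞) :
    ∀ᵐ ω ∂P, {i | Y i ω ∈ B}.Finite := by
  have hfin : ∫⁻ ω, hits Y B ω ∂P ≠ ∞ := by
    rw [hY.lintegral_hits_eq hB hvol]
    exact ENNReal.mul_ne_top ENNReal.ofReal_ne_top hvol.ne
  filter_upwards [ae_lt_top (measurable_hits hY.measurable hB) hfin] with ω hω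
  rw [hits_eq_encard] at hω
  rw [← Set.encard_lt_top_iff]
  exact_mod_cast hω

include hY in
-- The Poisson generating function. That `toNat` sends an infinite count to 0 does no harm, since
-- the law is carried by the finite counts.
theorem integral_pow_count (hlam : 0 ≤ lam) {B : Set Plane} (hB : MeasurableSet B)
    (hvol : volume B < ∞) (w : ℝ) (hw : |w| ≤ 1) :
    ∫ ω, w ^ (count Y B ω).toNat ∂P = Real.exp (-(lam * volume.real B * (1 - w))) := by
  have hc : Measurable (Nat.cast : ℕ → ℕ∞) := measurable_of_countable _
  have h1 : ∫ ω, w ^ (count Y B ω).toNat ∂P = ∫ k, w ^ (ENat.toNat k) ∂(P.map (count Y B)) := by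
    rw [integral_map (hY.measurable_count hB).aemeasurable
      (measurable_of_countable _).aestronglyMeasurable]
  rw [h1, hY.map_count hB hvol, integral_map hc.aemeasurable
    (measurable_of_countable _).aestronglyMeasurable]
  simp only [ENat.toNat_natCast]
  have hint : Integrable (fun n : ℕ => w ^ n)
      (poissonMeasure (Real.toNNReal (lam * volume.real B))) := by
    refine Integrable.of_bound (measurable_of_countable _).aestronglyMeasurable 1
      (Filter.Eventually.of_forall fun n => ?_)
    rw [norm_pow]
    exact pow_le_one₀ (norm_nonneg _) hw
  rw [integral_countable hint]
  have h2 := hasSum_pow_mul_poisson (Real.toNNReal (lam * volume.real B)) w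
  rw [Real.coe_toNNReal _ (mul_nonneg hlam measureReal_nonneg)] at h2
  rw [← h2.tsum_eq]
  refine tsum_congr fun n => ?_
  rw [poissonMeasure_real_singleton, smul_eq_mul, mul_comm,
    Real.coe_toNNReal _ (mul_nonneg hlam measureReal_nonneg)]

include hY in
-- In the limit the product becomes ∏ (1 - c_l)^(count in B_l). Counts of disjoint sets are
-- independent, so its mean is a product of Poisson generating functions.
theorem tendsto_integral_prod_indicator (hlam : 0 ≤ lam) {m : ℕ} {B : Fin m → Set Plane}
    (hB : ∀ l, MeasurableSet (B l)) (hvol : ∀ l, volume (B l) < ∞)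
    (hdisj : Pairwise fun l l' => Disjoint (B l) (B l')) {c : Fin m → ℝ}
    (hc : ∀ l, 0 ≤ c l ∧ c l ≤ 1) :
    Filter.Tendsto (fun n => ∫ ω, ∏ i ∈ Finset.range n,
        ∏ l, (1 - (B l).indicator (fun _ => c l) (Y i ω)) ∂P)
      Filter.atTop (nhds (Real.exp (-(lam * ∑ l, c l * volume.real (B l))))) := by
  have hval : ∫ ω, ∏ l, (1 - c l) ^ (count Y (B l) ω).toNat ∂P =
      Real.exp (-(lam * ∑ l, c l * volume.real (B l))) := by
    rw [(hY.indep m B hB hdisj).integral_fun_prod_comp (f := fun l k => (1 - c l) ^ (ENat.toNat k))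
      (fun l => (hY.measurable_count (hB l)).aemeasurable)
      fun l => (measurable_of_countable _).aestronglyMeasurable, Finset.mul_sum,
      ← Finset.sum_neg_distrib, Real.exp_sum]
    refine Finset.prod_congr rfl fun l _ => ?_
    rw [hY.integral_pow_count hlam (hB l) (hvol l) _
      (abs_le.2 ⟨by linarith [(hc l).2], by linarith [(hc l).1]⟩)]
    congr 1
    ring
  rw [← hval]
  have hbd : ∀ (l : Fin m) (y : Plane), 0 ≤ 1 - (B l).indicator (fun _ => c l) y ∧
      1 - (B l).indicator (fun _ => c l) y ≤ 1 := by
    intro l y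
    by_cases hy : y ∈ B l <;> simp [hy, hc l]
  refine tendsto_integral_of_dominated_convergence (fun _ => 1) (fun n => ?_) (integrable_const _)
    (fun n => Filter.Eventually.of_forall fun ω => ?_) ?_
  · refine Measurable.aestronglyMeasurable ?_
    refine Finset.measurable_prod _ fun i _ => Finset.measurable_prod _ fun l _ => ?_
    exact measurable_const.sub ((measurable_const.indicator (hB l)).comp (hY.measurable i))
  · rw [Real.norm_eq_abs, abs_of_nonneg
      (Finset.prod_nonneg fun i _ => Finset.prod_nonneg fun l _ => (hbd l _).1)]
    exact Finset.prod_le_one (fun i _ => Finset.prod_nonneg fun l _ => (hbd l _).1) fun i _ =>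
      Finset.prod_le_one (fun l _ => (hbd l _).1) fun l _ => (hbd l _).2
  · filter_upwards [ae_all_iff.2 fun l => hY.ae_finite (hB l) (hvol l)] with ω hω
    simp_rw [Finset.prod_comm (s := Finset.range _)]
    exact tendsto_finsetProd _ fun l _ => tendsto_prod_range (hω l) (c l)

include hY in
theorem tendsto_integral_prod_simpleFunc (hlam : 0 ≤ lam) (φ : SimpleFunc Plane ℝ)
    (hφ : ∀ y, 0 ≤ φ y ∧ φ y ≤ 1) (hint : Integrable φ volume) :
    Filter.Tendsto (fun n => ∫ ω, ∏ i ∈ Finset.range n, (1 - φ (Y i ω)) ∂P)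
      Filter.atTop (nhds (Real.exp (-(lam * ∫ y, φ y)))) := by
  classical
  -- The value 0 is left out: its level set has infinite area, and it contributes only factors 1.
  set t := φ.range.filter fun c => c ≠ 0 with ht
  let e := t.equivFin
  have hmem : ∀ l, (e.symm l : ℝ) ∈ φ.range ∧ (e.symm l : ℝ) ≠ 0 := fun l =>
    Finset.mem_filter.1 (e.symm l).2
  have h := hY.tendsto_integral_prod_indicator hlam (m := t.card)
    (B := fun l => φ ⁻¹' {(e.symm l : ℝ)}) (c := fun l => e.symm l)
    (fun l => φ.measurableSet_fiber _)
    (fun l => (SimpleFunc.integrable_iff.1 hint) _ (hmem l).2)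
    (fun l l' hll => by
      refine Set.disjoint_left.2 fun y hy hy' => hll ?_
      simp only [mem_preimage, mem_singleton_iff] at hy hy'
      exact e.symm.injective (Subtype.ext (hy.symm.trans hy')))
    (fun l => by
      obtain ⟨y, hy⟩ := SimpleFunc.mem_range.1 (hmem l).1
      rw [← hy]
      exact hφ y)
  have hpt : ∀ y, ∏ l, (1 - (φ ⁻¹' {(e.symm l : ℝ)}).indicator (fun _ => (e.symm l : ℝ)) y) =
      1 - φ y := by
    intro y
    rw [Equiv.prod_comp e.symm fun c : t => (1 - (φ ⁻¹' {(c : ℝ)}).indicator (fun _ => (c : ℝ)) y),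
      Finset.prod_coe_sort t fun c => (1 - (φ ⁻¹' {c}).indicator (fun _ => c) y)]
    by_cases h0 : φ y = 0
    · rw [h0, sub_zero]
      refine Finset.prod_eq_one fun c hc => ?_
      rw [indicator_of_notMem, sub_zero]
      rw [mem_preimage, h0, mem_singleton_iff]
      exact (Finset.mem_filter.1 hc).2.symm
    · rw [Finset.prod_eq_single_of_mem (φ y)
        (Finset.mem_filter.2 ⟨φ.mem_range_self y, h0⟩)]
      · rw [indicator_of_mem (by simp)]
      · intro c _ hc
        rw [indicator_of_notMem, sub_zero]
        simpa using hc.symm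
  have hsum : ∑ l, (e.symm l : ℝ) * volume.real (φ ⁻¹' {(e.symm l : ℝ)}) = ∫ y, φ y := by
    rw [Equiv.sum_comp e.symm fun c : t => (c : ℝ) * volume.real (φ ⁻¹' {(c : ℝ)}),
      Finset.sum_coe_sort t fun c => c * volume.real (φ ⁻¹' {c}),
      SimpleFunc.integral_eq_sum _ hint, ht, Finset.sum_filter]
    refine Finset.sum_congr rfl fun c _ => ?_
    by_cases hc : c = 0 <;> simp [hc, mul_comm]
  simp only [hpt] at h
  rwa [hsum] at h

include hY in
/-- The probability generating functional. -/
theorem tendsto_integral_prod (hlam : 0 ≤ lam) {q : Plane → ℝ} (hq : Measurable q)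
    (hq01 : ∀ y, 0 ≤ q y ∧ q y ≤ 1) (hint : Integrable q volume) :
    Filter.Tendsto (fun n => ∫ ω, ∏ i ∈ Finset.range n, (1 - q (Y i ω)) ∂P)
      Filter.atTop (nhds (Real.exp (-(lam * ∫ y, q y)))) := by
  have h01 : (0 : ℝ) ∈ Icc (0 : ℝ) 1 := by simp
  let φ : ℕ → SimpleFunc Plane ℝ := SimpleFunc.approxOn q hq (Icc 0 1) 0 h01
  have hφ : ∀ m y, 0 ≤ φ m y ∧ φ m y ≤ 1 := fun m y => by
    have h : φ m y ∈ Icc (0 : ℝ) 1 := SimpleFunc.approxOn_mem hq h01 m y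
    exact ⟨h.1, h.2⟩
  have hφint : ∀ m, Integrable (φ m) volume := fun m =>
    SimpleFunc.integrable_approxOn hq hint _ (integrable_zero _ _ _) m
  have hL1 : Filter.Tendsto (fun m => ∫ y, |φ m y - q y|) Filter.atTop (nhds 0) := by
    have h := SimpleFunc.tendsto_approxOn_L1_enorm (f := q) hq (s := Icc 0 1) (y₀ := 0) (by simp)
      (μ := volume) (Filter.Eventually.of_forall fun y => subset_closure (hq01 y))
      (by simpa using hint.2)
    have h2 := (ENNReal.tendsto_toReal ENNReal.zero_ne_top).comp h
    refine h2.congr fun m => ?_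
    exact (integral_norm_eq_lintegral_enorm (μ := volume)
      ((φ m).measurable.sub hq).aestronglyMeasurable).symm
  have hmeas : ∀ (n : ℕ) {f : Plane → ℝ}, Measurable f → (∀ y, 0 ≤ f y ∧ f y ≤ 1) →
      Integrable (fun ω => ∏ i ∈ Finset.range n, (1 - f (Y i ω))) P := by
    intro n f hf hf01
    refine Integrable.of_bound (Measurable.aestronglyMeasurable ?_) 1
      (Filter.Eventually.of_forall fun ω => ?_)
    · exact Finset.measurable_prod _ fun i _ => measurable_const.sub (hf.comp (hY.measurable i))
    · rw [Real.norm_eq_abs, abs_of_nonneg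
        (Finset.prod_nonneg fun i _ => sub_nonneg.2 (hf01 _).2)]
      exact Finset.prod_le_one (fun i _ => sub_nonneg.2 (hf01 _).2) fun i _ => by
        linarith [(hf01 (Y i ω)).1]
  -- By Campbell's formula the error of replacing `q` by a simple function is controlled in L¹,
  -- uniformly in `n`. This permits the exchange of the limits in `m` and `n`.
  have hbound : ∀ m n, |∫ ω, ∏ i ∈ Finset.range n, (1 - q (Y i ω)) ∂P -
      ∫ ω, ∏ i ∈ Finset.range n, (1 - φ m (Y i ω)) ∂P| ≤ lam * ∫ y, |φ m y - q y| := by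
    intro m n
    have hd : Measurable fun y => |φ m y - q y| := ((φ m).measurable.sub hq).abs
    have hdi : Integrable (fun y => |φ m y - q y|) volume := ((hφint m).sub hint).abs
    rw [← integral_sub (hmeas n hq hq01) (hmeas n (φ m).measurable (hφ m))]
    have h1 : ENNReal.ofReal |∫ ω, (∏ i ∈ Finset.range n, (1 - q (Y i ω)) -
        ∏ i ∈ Finset.range n, (1 - φ m (Y i ω))) ∂P| ≤
        ENNReal.ofReal (lam * ∫ y, |φ m y - q y|) := by
      calc _ ≤ ∫⁻ ω, ENNReal.ofReal |∏ i ∈ Finset.range n, (1 - q (Y i ω)) -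
            ∏ i ∈ Finset.range n, (1 - φ m (Y i ω))| ∂P := by
            simpa only [← Real.norm_eq_abs, ofReal_norm] using enorm_integral_le_lintegral_enorm _
        _ ≤ ∫⁻ ω, ∑ i ∈ Finset.range n, ENNReal.ofReal |φ m (Y i ω) - q (Y i ω)| ∂P := by
            refine lintegral_mono fun ω => ?_
            rw [← ENNReal.ofReal_sum_of_nonneg fun i _ => abs_nonneg _]
            refine ENNReal.ofReal_le_ofReal ((abs_prod_sub_prod_le _ _ _
              (fun i => ⟨sub_nonneg.2 (hq01 _).2, by linarith [(hq01 (Y i ω)).1]⟩)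
              (fun i => ⟨sub_nonneg.2 (hφ m _).2, by linarith [(hφ m (Y i ω)).1]⟩)).trans_eq ?_)
            refine Finset.sum_congr rfl fun i _ => ?_
            congr 1
            ring
        _ = ∑ i ∈ Finset.range n, ∫⁻ ω, ENNReal.ofReal |φ m (Y i ω) - q (Y i ω)| ∂P :=
            lintegral_finsetSum _ fun i _ => (hd.comp (hY.measurable i)).ennreal_ofReal
        _ ≤ ∑' i, ∫⁻ ω, ENNReal.ofReal |φ m (Y i ω) - q (Y i ω)| ∂P := ENNReal.sum_le_tsum _
        _ = ENNReal.ofReal lam * ∫⁻ y, ENNReal.ofReal |φ m y - q y| :=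
            hY.tsum_lintegral (f := fun y => ENNReal.ofReal |φ m y - q y|) hd.ennreal_ofReal
        _ = _ := by
            rw [ENNReal.ofReal_mul hlam, ofReal_integral_eq_lintegral_ofReal hdi
              (Filter.Eventually.of_forall fun y => abs_nonneg _)]
    exact (ENNReal.ofReal_le_ofReal_iff
      (mul_nonneg hlam (integral_nonneg fun y => abs_nonneg _))).1 h1
  have hunif : TendstoUniformly
      (fun m n => ∫ ω, ∏ i ∈ Finset.range n, (1 - φ m (Y i ω)) ∂P)
      (fun n => ∫ ω, ∏ i ∈ Finset.range n, (1 - q (Y i ω)) ∂P) Filter.atTop := by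
    rw [Metric.tendstoUniformly_iff]
    intro ε hε
    have h0 : Filter.Tendsto (fun m => lam * ∫ y, |φ m y - q y|) Filter.atTop (nhds 0) := by
      simpa using hL1.const_mul lam
    filter_upwards [h0.eventually (gt_mem_nhds hε)] with m hm n
    exact (hbound m n).trans_lt hm
  have hlim : Filter.Tendsto (fun m => Real.exp (-(lam * ∫ y, φ m y))) Filter.atTop
      (nhds (Real.exp (-(lam * ∫ y, q y)))) := by
    refine (Real.continuous_exp.tendsto _).comp (Filter.Tendsto.neg (Filter.Tendsto.const_mul _ ?_))
    rw [tendsto_iff_dist_tendsto_zero]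
    refine squeeze_zero (fun _ => dist_nonneg) (fun m => ?_) hL1
    rw [Real.dist_eq, ← integral_sub (hφint m) hint]
    exact abs_integral_le_integral_abs
  exact hunif.tendsto_of_eventually_tendsto
    (Filter.Eventually.of_forall fun m => hY.tendsto_integral_prod_simpleFunc hlam (φ m) (hφ m)
      (hφint m)) hlim

end IsHPPP

end UDN

/-! ### Marking and superposition: the base stations as one Poisson cloud. -/

namespace UDN

instance : MeasurableSpace Channel := ⊤

instance : DiscreteMeasurableSpace Channel := ⟨fun _ => trivial⟩

variable {K : ℕ} (N : Network K)

namespace Network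

theorem chanProb_nonneg (j : Fin K) (c : Channel) (x : ℝ) : 0 ≤ N.chanProb j c x := by
  cases c
  · exact (N.los j).prob_nonneg x
  · exact sub_nonneg.2 ((N.los j).prob_le_one x)

theorem sum_chanProb (j : Fin K) (x : ℝ) : ∑ c, N.chanProb j c x = 1 := by
  change ∑ c ∈ {Channel.los, Channel.nlos}, N.chanProb j c x = 1
  simp [chanProb]

theorem chanProb_le_one (j : Fin K) (c : Channel) (x : ℝ) : N.chanProb j c x ≤ 1 := by
  rw [← N.sum_chanProb j x]
  exact Finset.single_le_sum (fun c _ => N.chanProb_nonneg j c x) (Finset.mem_univ c)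

theorem measurable_chanProb (j : Fin K) (c : Channel) : Measurable (N.chanProb j c) := by
  cases c
  · exact (N.los j).measurable_prob
  · exact measurable_const.sub (N.los j).measurable_prob

theorem measurable_linkDist (j : Fin K) : Measurable (N.linkDist j) := by
  unfold linkDist
  fun_prop

theorem measurable_chanProb_linkDist (j : Fin K) (c : Channel) :
    Measurable fun y => N.chanProb j c (N.linkDist j y) :=
  (N.measurable_chanProb j c).comp (N.measurable_linkDist j)

/-- The intensity measure of the base stations, as points of the set of triples of tier, channel
environment and horizontal position. -/
def intensity : Measure (Fin K × Channel × Plane) :=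
  ∑ j, ∑ c, (volume.withDensity fun y => ENNReal.ofReal (N.density j) *
    ENNReal.ofReal (N.chanProb j c (N.linkDist j y))).map fun y => (j, c, y)

theorem lintegral_intensity {f : Fin K × Channel × Plane → ℝ≥0∞} (hf : Measurable f) :
    ∫⁻ z, f z ∂N.intensity = ∑ j, ∑ c, ENNReal.ofReal (N.density j) *
      ∫⁻ y, ENNReal.ofReal (N.chanProb j c (N.linkDist j y)) * f (j, c, y) := by
  rw [intensity, lintegral_finsetSum_measure]
  refine Finset.sum_congr rfl fun j _ => ?_
  rw [lintegral_finsetSum_measure]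
  refine Finset.sum_congr rfl fun c _ => ?_
  have hi : Measurable fun y : Plane => (j, c, y) := by fun_prop
  have hp := (N.measurable_chanProb_linkDist j c).ennreal_ofReal
  have h1 : Measurable fun y => ENNReal.ofReal (N.density j) *
    ENNReal.ofReal (N.chanProb j c (N.linkDist j y)) := measurable_const.mul hp
  have h2 : Measurable fun y => f (j, c, y) := hf.comp hi
  rw [lintegral_map hf hi, lintegral_withDensity_eq_lintegral_mul _ h1 h2]
  refine Eq.trans ?_ (lintegral_const_mul _ (hp.mul h2))
  refine lintegral_congr fun y => ?_
  simp [mul_assoc]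

/-- The probability that a base station of tier `j` at the position `y` belongs to `A`. -/
def hitProb (A : Set (Fin K × Channel × Plane)) (j : Fin K) (y : Plane) : ℝ :=
  ∑ c, N.chanProb j c (N.linkDist j y) * A.indicator 1 (j, c, y)

theorem hitProb_compl (A : Set (Fin K × Channel × Plane)) (j : Fin K) (y : Plane) :
    N.hitProb Aᶜ j y = 1 - N.hitProb A j y := by
  rw [← N.sum_chanProb j (N.linkDist j y), hitProb, hitProb, ← Finset.sum_sub_distrib]
  refine Finset.sum_congr rfl fun c _ => ?_
  by_cases h : (j, c, y) ∈ A <;> simp [h]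

theorem hitProb_nonneg (A : Set (Fin K × Channel × Plane)) (j : Fin K) (y : Plane) :
    0 ≤ N.hitProb A j y :=
  Finset.sum_nonneg fun c _ => mul_nonneg (N.chanProb_nonneg j c _)
    (indicator_nonneg (fun _ _ => zero_le_one) _)

theorem hitProb_le_one (A : Set (Fin K × Channel × Plane)) (j : Fin K) (y : Plane) :
    N.hitProb A j y ≤ 1 := by
  have := N.hitProb_nonneg Aᶜ j y
  rw [hitProb_compl] at this
  linarith

theorem measurable_hitProb {A : Set (Fin K × Channel × Plane)} (hA : MeasurableSet A)
    (j : Fin K) : Measurable (N.hitProb A j) := by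
  refine Finset.measurable_sum _ fun c _ => (N.measurable_chanProb_linkDist j c).mul ?_
  have hi : Measurable fun y : Plane => (j, c, y) := by fun_prop
  exact (measurable_one.indicator hA).comp hi

theorem intensity_apply {A : Set (Fin K × Channel × Plane)} (hA : MeasurableSet A) :
    N.intensity A =
      ∑ j, ENNReal.ofReal (N.density j) * ∫⁻ y, ENNReal.ofReal (N.hitProb A j y) := by
  rw [← lintegral_indicator_one hA, N.lintegral_intensity (measurable_one.indicator hA)]
  refine Finset.sum_congr rfl fun j _ => ?_
  rw [← Finset.mul_sum, ← lintegral_finsetSum]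
  · congr 1
    refine lintegral_congr fun y => ?_
    have h0 : ∀ c, 0 ≤ N.chanProb j c (N.linkDist j y) * A.indicator 1 (j, c, y) := fun c =>
      mul_nonneg (N.chanProb_nonneg j c _) (indicator_nonneg (fun _ _ => zero_le_one) _)
    rw [hitProb, ENNReal.ofReal_sum_of_nonneg fun c _ => h0 c]
    refine Finset.sum_congr rfl fun c _ => ?_
    by_cases h : (j, c, y) ∈ A <;> simp [h]
  · intro c _
    have hi : Measurable fun y : Plane => (j, c, y) := by fun_prop
    exact (N.measurable_chanProb_linkDist j c).ennreal_ofReal.mul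
      ((measurable_one.indicator hA).comp hi)

end Network

variable {Ω : Type*} [MeasurableSpace Ω] {P : Measure Ω} [IsProbabilityMeasure P]
  {Y : Fin K → ℕ → Ω → Plane} {C : Fin K → ℕ → Ω → Channel}

/-- A base station as a triple of tier, channel environment and horizontal position. -/
def site (Y : Fin K → ℕ → Ω → Plane) (C : Fin K → ℕ → Ω → Channel) (s : Fin K × ℕ) (ω : Ω) :
    Fin K × Channel × Plane := (s.1, C s.1 s.2 ω, Y s.1 s.2 ω)

namespace IsDeployment

variable {N} (h : IsDeployment N P Y C)
include h

omit [IsProbabilityMeasure P] in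
theorem measurable_site (s : Fin K × ℕ) : Measurable (site Y C s) := by
  have h1 : Measurable (C s.1 s.2) := measurable_to_countable' fun c =>
    h.measurable_channel s.1 s.2 c
  exact measurable_const.prodMk (h1.prodMk ((h.hppp s.1).measurable s.2))

theorem setIntegral_channel (S : Finset (Fin K × ℕ)) (c : Fin K × ℕ → Channel) {V : Set Ω}
    (hV : MeasurableSet[MeasurableSpace.comap (fun ω j i => Y j i ω) inferInstance] V) :
    P.real ({ω | ∀ s ∈ S, C s.1 s.2 ω = c s} ∩ V) =
      ∫ ω in V, ∏ s ∈ S, N.chanProb s.1 (c s) (N.linkDist s.1 (Y s.1 s.2 ω)) ∂P := by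
  have hY : Measurable fun ω j i => Y j i ω := measurable_pi_lambda _ fun j =>
    measurable_pi_lambda _ fun i => (h.hppp j).measurable i
  have hm := hY.comap_le
  have hU : MeasurableSet {ω | ∀ s ∈ S, C s.1 s.2 ω = c s} := by
    simp only [ofPred_forall]
    exact Finset.measurableSet_biInter S fun s _ => h.measurable_channel s.1 s.2 (c s)
  rw [← integral_congr_ae (ae_restrict_of_ae (h.channel S c)), setIntegral_condExp hm _ hV,
    integral_indicator hU, setIntegral_const, smul_eq_mul, mul_one, measureReal_restrict_apply hU]
  exact (integrable_const (1 : ℝ)).indicator hU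

/-- The law of the marks of finitely many base stations. -/
theorem measureReal_forall_site {A : Set (Fin K × Channel × Plane)} (hA : MeasurableSet A)
    (S : Finset (Fin K × ℕ)) :
    P.real {ω | ∀ s ∈ S, site Y C s ω ∈ A} =
      ∫ ω, ∏ s ∈ S, N.hitProb A s.1 (Y s.1 s.2 ω) ∂P := by
  classical
  -- Once the channels of `S` are fixed to `c`, membership in `A` is the event `V c` about positions
  -- alone, and the conditional law of the channels applies. Summing over all `c` turns a sum of
  -- products into the product of the sums `hitProb`. The value `los` outside `S` is never read.
  let ext : (S → Channel) → Fin K × ℕ → Channel := fun c s =>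
    if hs : s ∈ S then c ⟨s, hs⟩ else Channel.los
  have hext : ∀ c (s : S), ext c s = c s := fun c s => by simp [ext]
  let U : (S → Channel) → Set Ω := fun c => {ω | ∀ s ∈ S, C s.1 s.2 ω = ext c s}
  let V : (S → Channel) → Set Ω := fun c => {ω | ∀ s ∈ S, (s.1, ext c s, Y s.1 s.2 ω) ∈ A}
  have hV : ∀ c, MeasurableSet[MeasurableSpace.comap (fun ω j i => Y j i ω) inferInstance] (V c) := by
    intro c
    simp only [V, ofPred_forall]
    refine Finset.measurableSet_biInter S fun s _ => ?_
    have hp : Measurable fun y : Fin K → ℕ → Plane => (s.1, ext c s, y s.1 s.2) := by fun_prop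
    exact ⟨_, hp hA, rfl⟩
  have hY : Measurable fun ω j i => Y j i ω := measurable_pi_lambda _ fun j =>
    measurable_pi_lambda _ fun i => (h.hppp j).measurable i
  have hV' : ∀ c, MeasurableSet (V c) := fun c => hY.comap_le _ (hV c)
  have hU : ∀ c, MeasurableSet (U c) := fun c => by
    simp only [U, ofPred_forall]
    exact Finset.measurableSet_biInter S fun s _ => h.measurable_channel s.1 s.2 _
  have hsplit : {ω | ∀ s ∈ S, site Y C s ω ∈ A} = ⋃ c ∈ (Finset.univ : Finset (S → Channel)),
      (U c ∩ V c) := by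
    ext ω
    simp only [mem_iUnion, mem_ofPred_eq, mem_inter_iff, U, V, site, Finset.mem_univ,
      exists_prop, true_and]
    constructor
    · intro hω
      have he : ∀ s ∈ S, C s.1 s.2 ω = ext (fun s => C s.1.1 s.1.2 ω) s := fun s hs => by
        simp [ext, hs]
      exact ⟨fun s => C s.1.1 s.1.2 ω, he, fun s hs => he s hs ▸ hω s hs⟩
    · rintro ⟨c, h1, h2⟩ s hs
      rw [h1 s hs]
      exact h2 s hs
  have hdisj : Set.PairwiseDisjoint (Finset.univ : Finset (S → Channel))
      (fun c => U c ∩ V c) := by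
    intro c _ c' _ hne
    refine Set.disjoint_left.2 fun ω hω hω' => hne ?_
    funext s
    rw [← hext c s, ← hext c' s, ← hω.1 s s.2, ← hω'.1 s s.2]
  rw [hsplit, measureReal_biUnion_finset hdisj fun c _ => (hU c).inter (hV' c)]
  have hmp : ∀ s : Fin K × ℕ, ∀ c, Measurable fun ω =>
      N.chanProb s.1 c (N.linkDist s.1 (Y s.1 s.2 ω)) := fun s c =>
    (N.measurable_chanProb_linkDist s.1 c).comp ((h.hppp s.1).measurable s.2)
  have hterm : ∀ c : S → Channel, P.real (U c ∩ V c) =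
      ∫ ω, (V c).indicator (fun ω => ∏ s ∈ S, N.chanProb s.1 (ext c s)
        (N.linkDist s.1 (Y s.1 s.2 ω))) ω ∂P := fun c => by
    rw [integral_indicator (hV' c)]
    exact h.setIntegral_channel S (ext c) (hV c)
  rw [Finset.sum_congr rfl fun c _ => hterm c, ← integral_finsetSum]
  · refine integral_congr_ae (Filter.Eventually.of_forall fun ω => ?_)
    change _ = ∏ s ∈ S, N.hitProb A s.1 (Y s.1 s.2 ω)
    rw [← Finset.prod_coe_sort S]
    simp only [Network.hitProb]
    rw [Finset.prod_univ_sum, Fintype.piFinset_univ]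
    refine Finset.sum_congr rfl fun c _ => ?_
    by_cases hω : ω ∈ V c
    · rw [indicator_of_mem hω, ← Finset.prod_coe_sort S]
      refine Finset.prod_congr rfl fun s _ => ?_
      have := hω s s.2
      rw [hext] at this ⊢
      simp [this]
    · rw [indicator_of_notMem hω]
      simp only [V, mem_ofPred_eq, not_forall] at hω
      obtain ⟨s, hs, hsA⟩ := hω
      symm
      refine Finset.prod_eq_zero (Finset.mem_univ ⟨s, hs⟩) ?_
      rw [← hext c ⟨s, hs⟩, indicator_of_notMem hsA, mul_zero]
  · intro c _
    refine Integrable.indicator (Integrable.of_bound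
      (Finset.measurable_prod _ fun s _ => hmp s _).aestronglyMeasurable 1
      (Filter.Eventually.of_forall fun ω => ?_)) (hV' c)
    rw [Real.norm_eq_abs, abs_of_nonneg (Finset.prod_nonneg fun s _ => N.chanProb_nonneg _ _ _)]
    exact Finset.prod_le_one (fun s _ => N.chanProb_nonneg _ _ _) fun s _ =>
      N.chanProb_le_one _ _ _

theorem measure_site_preimage {A : Set (Fin K × Channel × Plane)} (hA : MeasurableSet A)
    (s : Fin K × ℕ) :
    P (site Y C s ⁻¹' A) = ∫⁻ ω, ENNReal.ofReal (N.hitProb A s.1 (Y s.1 s.2 ω)) ∂P := by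
  have h1 := h.measureReal_forall_site hA {s}
  simp only [Finset.mem_singleton, forall_eq, Finset.prod_singleton] at h1
  rw [← ofReal_integral_eq_lintegral_ofReal _ (Filter.Eventually.of_forall fun ω =>
    N.hitProb_nonneg _ _ _), ← h1, ofReal_measureReal]
  · rfl
  refine Integrable.of_bound ((N.measurable_hitProb hA s.1).comp
    ((h.hppp s.1).measurable s.2)).aestronglyMeasurable 1 (Filter.Eventually.of_forall fun ω => ?_)
  rw [Real.norm_eq_abs, abs_of_nonneg (N.hitProb_nonneg _ _ _)]
  exact N.hitProb_le_one _ _ _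

omit [IsProbabilityMeasure P] in
theorem integral_prod_prod {q : Fin K → Plane → ℝ} (hq : ∀ j, Measurable (q j)) (n : ℕ) :
    ∫ ω, ∏ s ∈ Finset.univ ×ˢ Finset.range n, q s.1 (Y s.1 s.2 ω) ∂P =
      ∏ j, ∫ ω, ∏ i ∈ Finset.range n, q j (Y j i ω) ∂P := by
  let f : Fin K → (ℕ → Plane) → ℝ := fun j y => ∏ i ∈ Finset.range n, q j (y i)
  have hf : ∀ j, Measurable (f j) := fun j =>
    Finset.measurable_prod _ fun i _ => (hq j).comp (measurable_pi_apply i)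
  have hY : ∀ j, Measurable fun ω i => Y j i ω := fun j =>
    measurable_pi_lambda _ fun i => (h.hppp j).measurable i
  have h1 := ProbabilityTheory.iIndepFun.integral_fun_prod_comp (f := f) h.indep_tiers
    (fun j => (hY j).aemeasurable) fun j => (hf j).aestronglyMeasurable
  simp only [Finset.prod_product]
  exact h1

/-- The base stations with their marks form a Poisson process. -/
theorem isPoissonCloud : IsPoissonCloud P (site Y C) N.intensity where
  measurable := h.measurable_site
  mean A hA := by
    rw [ENNReal.tsum_prod', tsum_fintype, N.intensity_apply hA]
    refine Finset.sum_congr rfl fun j _ => ?_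
    rw [← (h.hppp j).tsum_lintegral (N.measurable_hitProb hA j).ennreal_ofReal]
    exact tsum_congr fun i => h.measure_site_preimage hA (j, i)
  void A hA hfin := by
    have hfin' := hfin
    rw [N.intensity_apply hA] at hfin'
    have hint : ∀ j, Integrable (N.hitProb A j) volume := by
      intro j
      refine ⟨(N.measurable_hitProb hA j).aestronglyMeasurable, ?_⟩
      rw [hasFiniteIntegral_iff_ofReal (Filter.Eventually.of_forall fun y => N.hitProb_nonneg A j y)]
      have h1 := (ENNReal.sum_lt_top.1 hfin') j (Finset.mem_univ j)
      rcases ENNReal.mul_lt_top_iff.1 h1 with h2 | h2 | h2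
      · exact h2.2
      · exact absurd (ENNReal.ofReal_eq_zero.1 h2) (N.density_pos j).not_ge
      · rw [h2]; exact ENNReal.zero_lt_top
    have hval : N.intensity.real A = ∑ j, N.density j * ∫ y, N.hitProb A j y := by
      rw [Measure.real, N.intensity_apply hA, ENNReal.toReal_sum
        fun j hj => ((ENNReal.sum_lt_top.1 hfin') j hj).ne]
      refine Finset.sum_congr rfl fun j _ => ?_
      rw [ENNReal.toReal_mul, ENNReal.toReal_ofReal (N.density_pos j).le,
        integral_eq_lintegral_of_nonneg_ae
          (Filter.Eventually.of_forall fun y => N.hitProb_nonneg A j y) (hint j).1]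
    -- The first `n` stations of each tier miss `A`. This probability factors over the independent
    -- tiers, and each factor converges by the generating functional with `q = hitProb`.
    let V : ℕ → Set Ω := fun n => {ω | ∀ s ∈ Finset.univ ×ˢ Finset.range n, site Y C s ω ∈ Aᶜ}
    have hVm : ∀ n, MeasurableSet (V n) := fun n => by
      simp only [V, ofPred_forall]
      exact Finset.measurableSet_biInter _ fun s _ => h.measurable_site s hA.compl
    have hV : avoid (site Y C) A = ⋂ n, V n := by
      ext ω
      simp only [avoid, mem_iInter, V, mem_ofPred_eq]
      exact ⟨fun hω n s _ => hω s, fun hω s => hω (s.2 + 1) s (by simp)⟩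
    have hanti : Antitone V := fun n m hnm ω hω s hs => hω s
      (Finset.product_subset_product_right (Finset.range_subset_range.2 hnm) hs)
    have hlim := tendsto_measure_iInter_atTop (μ := P) (fun n => (hVm n).nullMeasurableSet) hanti
      ⟨0, measure_ne_top _ _⟩
    rw [← hV] at hlim
    refine tendsto_nhds_unique hlim ?_
    have hpr : ∀ n, P (V n) = ENNReal.ofReal
        (∏ j, ∫ ω, ∏ i ∈ Finset.range n, (1 - N.hitProb A j (Y j i ω)) ∂P) := by
      intro n
      rw [← ofReal_measureReal, h.measureReal_forall_site hA.compl]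
      congr 1
      rw [h.integral_prod_prod fun j => N.measurable_hitProb hA.compl j]
      simp only [N.hitProb_compl]
    simp_rw [Function.comp_def, hpr]
    refine ENNReal.tendsto_ofReal ?_
    rw [hval, ← Finset.sum_neg_distrib, Real.exp_sum]
    exact tendsto_finsetProd _ fun j _ => (h.hppp j).tendsto_integral_prod (N.density_pos j).le
      (N.measurable_hitProb hA j) (fun y => ⟨N.hitProb_nonneg A j y, N.hitProb_le_one A j y⟩) (hint j)

end IsDeployment

end UDN

/-! ### Link distances in polar coordinates, and mean counts. -/

namespace UDN

theorem ext_of_Iic_of_ne_top {μ ν : Measure ℝ}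
    (h : ∀ R, μ (Iic R) ≠ ∞ ∧ μ (Iic R) = ν (Iic R)) : μ = ν := by
  have h3 : ∀ a b : ℝ, Ioc a b = Iic b \ Iic a := fun a b => by
    ext x; simp [and_comm]
  refine Measure.ext_of_Ioc' _ _ (fun a b _ => ?_) fun a b hab => ?_
  · exact ne_top_of_le_ne_top (h b).1 (measure_mono Ioc_subset_Iic_self)
  · rw [h3, measure_sdiff (Iic_subset_Iic.2 hab.le) measurableSet_Iic.nullMeasurableSet (h a).1,
      measure_sdiff (Iic_subset_Iic.2 hab.le) measurableSet_Iic.nullMeasurableSet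
        ((h a).2 ▸ (h a).1), (h a).2, (h b).2]

namespace Network

variable {K : ℕ} (N : Network K)

theorem height_nonneg (j : Fin K) : 0 ≤ N.height j := sub_nonneg.2 (N.userHeight_le j)

theorem height_le_linkDist (j : Fin K) (y : Plane) : N.height j ≤ N.linkDist j y :=
  Real.le_sqrt_of_sq_le (by nlinarith [sq_nonneg ‖y‖])

theorem linkDist_nonneg (j : Fin K) (y : Plane) : 0 ≤ N.linkDist j y := Real.sqrt_nonneg _

theorem volume_linkDist_le (j : Fin K) (R : ℝ) :
    volume {y | N.linkDist j y ≤ R} =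
      ENNReal.ofReal (Real.pi * (max (N.height j) R ^ 2 - N.height j ^ 2)) := by
  have h0 := N.height_nonneg j
  rcases lt_or_ge R (N.height j) with hR | hR
  · have : {y | N.linkDist j y ≤ R} = ∅ := by
      ext y
      simpa using hR.trans_le (N.height_le_linkDist j y)
    rw [this, max_eq_left hR.le]
    simp
  · have hnn : 0 ≤ R ^ 2 - N.height j ^ 2 := by nlinarith
    have : {y | N.linkDist j y ≤ R} = Metric.closedBall 0 (√(R ^ 2 - N.height j ^ 2)) := by
      ext y
      rw [mem_ofPred_eq, mem_closedBall_zero_iff, linkDist, Real.sqrt_le_left (h0.trans hR),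
        Real.le_sqrt (norm_nonneg y) hnn]
      constructor <;> intro h <;> linarith
    rw [this, EuclideanSpace.volume_closedBall_fin_two, max_eq_right hR,
      ← ENNReal.ofReal_pow (Real.sqrt_nonneg _), Real.sq_sqrt hnn, mul_comm,
      ENNReal.ofReal_mul Real.pi_pos.le, ENNReal.ofReal_eq_coe_nnreal Real.pi_pos.le]

theorem lintegral_two_pi_mul {h R : ℝ} (h0 : 0 ≤ h) :
    ∫⁻ t in Ici h ∩ Iic R, ENNReal.ofReal (2 * Real.pi * t) =
      ENNReal.ofReal (Real.pi * (max h R ^ 2 - h ^ 2)) := by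
  rw [Ici_inter_Iic]
  rcases lt_or_ge R h with hR | hR
  · rw [Icc_eq_empty hR.not_ge, max_eq_left hR.le]
    simp
  · rw [max_eq_right hR, ← ofReal_integral_eq_lintegral_ofReal]
    · rw [integral_Icc_eq_integral_Ioc, ← intervalIntegral.integral_of_le hR,
        intervalIntegral.integral_const_mul, integral_id]
      congr 1
      ring
    · exact (by fun_prop : Continuous fun t : ℝ => 2 * Real.pi * t).continuousOn.integrableOn_compact
        isCompact_Icc
    · refine (ae_restrict_iff' measurableSet_Icc).2 (Filter.Eventually.of_forall fun t ht => ?_)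
      have : 0 ≤ t := h0.trans ht.1
      change 0 ≤ 2 * Real.pi * t
      positivity

/-- The link distance in tier `j` has the intensity `2πt` on `[h_j, ∞)`. -/
theorem map_linkDist (j : Fin K) :
    (volume : Measure Plane).map (N.linkDist j) =
      (volume.restrict (Ici (N.height j))).withDensity fun t => ENNReal.ofReal (2 * Real.pi * t) := by
  have h1 : ∀ R, (volume : Measure Plane).map (N.linkDist j) (Iic R) =
      ENNReal.ofReal (Real.pi * (max (N.height j) R ^ 2 - N.height j ^ 2)) := fun R => by
    rw [Measure.map_apply (N.measurable_linkDist j) measurableSet_Iic]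
    exact N.volume_linkDist_le j R
  have h2 : ∀ R, (volume.restrict (Ici (N.height j))).withDensity
      (fun t => ENNReal.ofReal (2 * Real.pi * t)) (Iic R) =
      ENNReal.ofReal (Real.pi * (max (N.height j) R ^ 2 - N.height j ^ 2)) := fun R => by
    rw [withDensity_apply _ measurableSet_Iic, Measure.restrict_restrict measurableSet_Iic,
      inter_comm, lintegral_two_pi_mul (N.height_nonneg j)]
  refine ext_of_Iic_of_ne_top fun R => ?_
  rw [h1, h2]
  exact ⟨ENNReal.ofReal_ne_top, rfl⟩

theorem lintegral_comp_linkDist (j : Fin K) {g : ℝ → ℝ≥0∞} (hg : Measurable g) :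
    ∫⁻ y, g (N.linkDist j y) =
      ∫⁻ t in Ici (N.height j), ENNReal.ofReal (2 * Real.pi * t) * g t := by
  have hm : Measurable fun t : ℝ => ENNReal.ofReal (2 * Real.pi * t) := by fun_prop
  rw [← lintegral_map hg (N.measurable_linkDist j), map_linkDist,
    lintegral_withDensity_eq_lintegral_mul _ hm hg]
  rfl

theorem integrableOn_mul_chanProb (j : Fin K) (c : Channel) (a b : ℝ) :
    IntegrableOn (fun t => t * N.chanProb j c t) (Icc a b) := by
  refine Integrable.mono' (g := fun t => |t|) ?_
    (measurable_id.mul (N.measurable_chanProb j c)).aestronglyMeasurable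
    (Filter.Eventually.of_forall fun t => ?_)
  · exact continuous_abs.continuousOn.integrableOn_compact isCompact_Icc
  · rw [norm_mul, Real.norm_eq_abs, Real.norm_eq_abs, abs_of_nonneg (N.chanProb_nonneg j c t)]
    exact mul_le_of_le_one_right (abs_nonneg t) (N.chanProb_le_one j c t)

theorem setIntegral_chanProb_nonneg (j : Fin K) (c : Channel) (R : ℝ) :
    0 ≤ ∫ t in Icc (N.height j) R, t * N.chanProb j c t :=
  setIntegral_nonneg measurableSet_Icc fun t ht =>
    mul_nonneg ((N.height_nonneg j).trans ht.1) (N.chanProb_nonneg j c t)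

theorem setIntegral_chanProb_mono (j : Fin K) (c : Channel) {R R' : ℝ} (hR : R ≤ R') :
    ∫ t in Icc (N.height j) R, t * N.chanProb j c t ≤
      ∫ t in Icc (N.height j) R', t * N.chanProb j c t := by
  refine setIntegral_mono_set (N.integrableOn_mul_chanProb j c _ _) ?_
    (Icc_subset_Icc_right hR).eventuallyLE
  refine (ae_restrict_iff' measurableSet_Icc).2 (Filter.Eventually.of_forall fun t ht => ?_)
  exact mul_nonneg ((N.height_nonneg j).trans ht.1) (N.chanProb_nonneg j c t)

theorem continuous_setIntegral_chanProb (j : Fin K) (c : Channel) :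
    Continuous fun R => ∫ t in Icc (N.height j) R, t * N.chanProb j c t := by
  -- For `R` below the height the set integral is 0, whereas an interval integral up to `R` would be
  -- oriented backwards; the `max` reconciles the two.
  have h : ∀ R, ∫ t in Icc (N.height j) R, t * N.chanProb j c t =
      ∫ t in (N.height j)..(max (N.height j) R), t * N.chanProb j c t := by
    intro R
    rw [intervalIntegral.integral_of_le (le_max_left _ _), ← integral_Icc_eq_integral_Ioc]
    rcases le_or_gt (N.height j) R with hR | hR
    · rw [max_eq_right hR]
    · rw [max_eq_left hR.le, Icc_eq_empty hR.not_ge, Icc_self]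
      simp
  simp_rw [h]
  refine (intervalIntegral.continuous_primitive (fun a b => ?_) _).comp (by fun_prop)
  exact IntegrableOn.intervalIntegrable (N.integrableOn_mul_chanProb j c _ _)

theorem meanCount_nonneg (R : Fin K → Channel → ℝ) : 0 ≤ N.meanCount R :=
  Finset.sum_nonneg fun j _ => mul_nonneg (mul_nonneg Real.two_pi_pos.le (N.density_pos j).le)
    (Finset.sum_nonneg fun c _ => N.setIntegral_chanProb_nonneg j c _)

theorem meanCount_mono {R R' : Fin K → Channel → ℝ} (h : ∀ j c, R j c ≤ R' j c) :
    N.meanCount R ≤ N.meanCount R' :=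
  Finset.sum_le_sum fun j _ => mul_le_mul_of_nonneg_left
    (Finset.sum_le_sum fun c _ => N.setIntegral_chanProb_mono j c (h j c))
    (mul_nonneg Real.two_pi_pos.le (N.density_pos j).le)

theorem continuous_meanCount : Continuous fun R : Fin K → Channel → ℝ => N.meanCount R := by
  unfold meanCount
  refine continuous_finsetSum _ fun j _ => continuous_const.mul
    (continuous_finsetSum _ fun c _ => ?_)
  exact (N.continuous_setIntegral_chanProb j c).comp (by fun_prop)

/-- Up to the common radius `m` the channel probabilities add up to 1, so tier `j` alone contributes
its density times a disc area, whatever the blockage. -/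
theorem le_meanCount (R : Fin K → Channel → ℝ) (j : Fin K) {m : ℝ} (hm0 : N.height j ≤ m)
    (hm : ∀ c, m ≤ R j c) :
    Real.pi * N.density j * (m ^ 2 - N.height j ^ 2) ≤ N.meanCount R := by
  have hpos : 0 ≤ 2 * Real.pi * N.density j :=
    mul_nonneg Real.two_pi_pos.le (N.density_pos j).le
  have h1 : ∑ c, ∫ t in Icc (N.height j) m, t * N.chanProb j c t =
      (m ^ 2 - N.height j ^ 2) / 2 := by
    rw [← integral_finsetSum _ fun c _ => N.integrableOn_mul_chanProb j c _ _]
    simp_rw [← Finset.mul_sum, N.sum_chanProb, mul_one]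
    rw [integral_Icc_eq_integral_Ioc, ← intervalIntegral.integral_of_le hm0, integral_id]
  calc Real.pi * N.density j * (m ^ 2 - N.height j ^ 2)
      = 2 * Real.pi * N.density j * ∑ c, ∫ t in Icc (N.height j) m, t * N.chanProb j c t := by
        rw [h1]; ring
    _ ≤ 2 * Real.pi * N.density j *
        ∑ c, ∫ t in Icc (N.height j) (R j c), t * N.chanProb j c t :=
        mul_le_mul_of_nonneg_left
          (Finset.sum_le_sum fun c _ => N.setIntegral_chanProb_mono j c (hm c)) hpos
    _ ≤ N.meanCount R := Finset.single_le_sum (f := fun j => 2 * Real.pi * N.density j *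
        ∑ c, ∫ t in Icc (N.height j) (R j c), t * N.chanProb j c t) (fun j _ =>
          mul_nonneg (mul_nonneg Real.two_pi_pos.le (N.density_pos j).le)
          (Finset.sum_nonneg fun c _ => N.setIntegral_chanProb_nonneg j c _)) (Finset.mem_univ j)

theorem setIntegral_chanProb_le (j : Fin K) (c : Channel) (R : ℝ) :
    ∫ t in Icc (N.height j) R, t * N.chanProb j c t ≤ R ^ 2 := by
  rcases lt_or_ge R (N.height j) with hR | hR
  · rw [Icc_eq_empty hR.not_ge]
    simp [sq_nonneg]
  calc ∫ t in Icc (N.height j) R, t * N.chanProb j c t ≤ ∫ t in Icc (N.height j) R, t := by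
        refine setIntegral_mono_on (N.integrableOn_mul_chanProb j c _ _)
          (continuous_id.continuousOn.integrableOn_compact isCompact_Icc) measurableSet_Icc
          fun t ht => ?_
        exact mul_le_of_le_one_right ((N.height_nonneg j).trans ht.1) (N.chanProb_le_one j c t)
    _ = (R ^ 2 - N.height j ^ 2) / 2 := by
        rw [integral_Icc_eq_integral_Ioc, ← intervalIntegral.integral_of_le hR, integral_id]
    _ ≤ R ^ 2 := by nlinarith [sq_nonneg R, sq_nonneg (N.height j)]

/-- The mean number of base stations with link distance at most `R`, for bounds `R` that depend on
the tier and on the channel environment. -/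
theorem intensity_linkDist_le (R : Fin K → Channel → ℝ) :
    N.intensity {z | N.linkDist z.1 z.2.2 ≤ R z.1 z.2.1} = ENNReal.ofReal (N.meanCount R) := by
  have hm : MeasurableSet {z : Fin K × Channel × Plane | N.linkDist z.1 z.2.2 ≤ R z.1 z.2.1} := by
    refine measurableSet_le ?_ ?_
    · refine measurable_from_prod_countable_right fun j => ?_
      exact (N.measurable_linkDist j).comp measurable_snd
    · have : Measurable fun q : Fin K × Channel => R q.1 q.2 := measurable_of_countable _
      exact this.comp (measurable_fst.prodMk (measurable_fst.comp measurable_snd))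
  rw [← lintegral_indicator_one hm, N.lintegral_intensity (measurable_one.indicator hm), meanCount,
    ENNReal.ofReal_sum_of_nonneg fun j _ => mul_nonneg
      (mul_nonneg Real.two_pi_pos.le (N.density_pos j).le)
      (Finset.sum_nonneg fun c _ => N.setIntegral_chanProb_nonneg j c _)]
  refine Finset.sum_congr rfl fun j _ => ?_
  rw [Finset.mul_sum, ENNReal.ofReal_sum_of_nonneg fun c _ => mul_nonneg
      (mul_nonneg Real.two_pi_pos.le (N.density_pos j).le) (N.setIntegral_chanProb_nonneg j c _)]
  refine Finset.sum_congr rfl fun c _ => ?_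
  have hg : Measurable fun t => ENNReal.ofReal (N.chanProb j c t) * (Iic (R j c)).indicator 1 t :=
    (N.measurable_chanProb j c).ennreal_ofReal.mul (measurable_one.indicator measurableSet_Iic)
  have h1 := N.lintegral_comp_linkDist j hg
  have h2 : ∀ y, ({z | N.linkDist z.1 z.2.2 ≤ R z.1 z.2.1} : Set (Fin K × Channel × Plane)).indicator
      (1 : Fin K × Channel × Plane → ℝ≥0∞) (j, c, y) = (Iic (R j c)).indicator 1 (N.linkDist j y) := fun y => rfl
  simp_rw [h2]
  rw [h1, show 2 * Real.pi * N.density j * ∫ t in Icc (N.height j) (R j c), t * N.chanProb j c t =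
    N.density j * ∫ t in Icc (N.height j) (R j c), 2 * Real.pi * (t * N.chanProb j c t) by
      rw [integral_const_mul]; ring, ENNReal.ofReal_mul (N.density_pos j).le,
    ofReal_integral_eq_lintegral_ofReal ((N.integrableOn_mul_chanProb j c _ _).const_mul _)
      ((ae_restrict_iff' measurableSet_Icc).2 (Filter.Eventually.of_forall fun t ht =>
        mul_nonneg Real.two_pi_pos.le (mul_nonneg ((N.height_nonneg j).trans ht.1)
          (N.chanProb_nonneg j c t)))), ← Ici_inter_Iic, inter_comm, ← setLIntegral_indicator measurableSet_Iic]
  congr 1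
  refine setLIntegral_congr_fun measurableSet_Ici fun t ht => ?_
  have ht0 : 0 ≤ t := (N.height_nonneg j).trans ht
  by_cases hR : t ∈ Iic (R j c)
  · simp only [indicator_of_mem hR, Pi.one_apply, mul_one]
    rw [← ENNReal.ofReal_mul (by positivity)]
    congr 1
    ring
  · simp only [indicator_of_notMem hR, mul_zero]

end Network
end UDN

/-! ### Power levels, and growth and decay in the main link distance. -/

namespace UDN

namespace Network

variable {K : ℕ} (N : Network K)

theorem pathloss_pos (c : Channel) : 0 < N.pathloss c := two_pos.trans_le (N.two_le_pathloss c)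

/-- The reciprocal of the average received power. -/
def pathGain (z : Fin K × Channel × Plane) : ℝ :=
  N.linkDist z.1 z.2.2 ^ N.pathloss z.2.1 / N.txPower z.1

/-- The mean number of base stations with average received power at least `1 / t`. -/
def powerCount (t : ℝ) : ℝ := N.meanCount fun j c => (N.txPower j * t) ^ (1 / N.pathloss c)

/-- The mean number of base stations of at least the average received power of `z`. -/
def level (z : Fin K × Channel × Plane) : ℝ :=
  N.meanCount fun j c => N.theta j c z.1 z.2.1 (N.linkDist z.1 z.2.2)

theorem measurable_linkDist_snd :
    Measurable fun z : Fin K × Channel × Plane => N.linkDist z.1 z.2.2 :=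
  measurable_from_prod_countable_right fun j => (N.measurable_linkDist j).comp measurable_snd

theorem measurable_of_fst_snd {α : Type*} [MeasurableSpace α] (f : Fin K → Channel → α) :
    Measurable fun z : Fin K × Channel × Plane => f z.1 z.2.1 := by
  have : Measurable fun q : Fin K × Channel => f q.1 q.2 := measurable_of_countable _
  exact this.comp (measurable_fst.prodMk (measurable_fst.comp measurable_snd))

theorem measurable_pathGain : Measurable N.pathGain := by
  unfold pathGain
  exact (N.measurable_linkDist_snd.pow (measurable_of_fst_snd fun _ c => N.pathloss c)).div
    (measurable_of_fst_snd fun j _ => N.txPower j)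

theorem pathGain_nonneg (z : Fin K × Channel × Plane) : 0 ≤ N.pathGain z :=
  div_nonneg (Real.rpow_nonneg (N.linkDist_nonneg _ _) _) (N.txPower_pos _).le

theorem avgPower_eq_inv (z : Fin K × Channel × Plane) :
    N.avgPower z.1 z.2.1 (N.linkDist z.1 z.2.2) = (N.pathGain z)⁻¹ := by
  rw [avgPower, pathGain, Real.rpow_neg (N.linkDist_nonneg _ _), inv_div, div_eq_mul_inv]

theorem theta_eq (j : Fin K) (c : Channel) (k : Fin K) (c₀ : Channel) {r : ℝ} (hr : 0 ≤ r) :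
    N.theta j c k c₀ r =
      (N.txPower j * (r ^ N.pathloss c₀ / N.txPower k)) ^ (1 / N.pathloss c) := by
  have hj := N.txPower_pos j
  have hk := N.txPower_pos k
  rw [theta, show N.txPower j * (r ^ N.pathloss c₀ / N.txPower k) =
    N.txPower j / N.txPower k * r ^ N.pathloss c₀ by ring,
    Real.mul_rpow (by positivity) (by positivity), ← Real.rpow_mul hr]
  congr 2
  ring

/-- The level factors through one scalar, so the monotonicity of `powerCount` links the order of
levels to the order of received powers. -/
theorem level_eq (z : Fin K × Channel × Plane) : N.level z = N.powerCount (N.pathGain z) := by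
  unfold level powerCount pathGain
  simp only [N.theta_eq _ _ _ _ (N.linkDist_nonneg _ _)]

theorem continuous_powerCount : Continuous N.powerCount := by
  refine N.continuous_meanCount.comp (continuous_pi fun j => continuous_pi fun c => ?_)
  exact (Real.continuous_rpow_const (one_div_nonneg.2 (N.pathloss_pos c).le)).comp
    (continuous_const.mul continuous_id)

theorem powerCount_mono {s t : ℝ} (hs : 0 ≤ s) (hst : s ≤ t) : N.powerCount s ≤ N.powerCount t :=
  N.meanCount_mono fun j c => Real.rpow_le_rpow (mul_nonneg (N.txPower_pos j).le hs)
    (mul_le_mul_of_nonneg_left hst (N.txPower_pos j).le) (one_div_nonneg.2 (N.pathloss_pos c).le)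

theorem powerCount_zero : N.powerCount 0 = 0 := by
  unfold powerCount meanCount
  refine Finset.sum_eq_zero fun j _ => mul_eq_zero_of_right _ (Finset.sum_eq_zero fun c _ => ?_)
  simp only [mul_zero, Real.zero_rpow (one_div_pos.2 (N.pathloss_pos c)).ne']
  refine setIntegral_measure_zero _ (measure_mono_null (Icc_subset_Icc_left (N.height_nonneg j)) ?_)
  simp

theorem exists_le_powerCount (hK : 0 < K) (a : ℝ) : ∃ t, 0 ≤ t ∧ a ≤ N.powerCount t := by
  let j : Fin K := ⟨0, hK⟩
  have hpos : 0 < Real.pi * N.density j := mul_pos Real.pi_pos (N.density_pos j)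
  obtain ⟨m, hm0, hm⟩ : ∃ m, N.height j ≤ m ∧ a ≤ Real.pi * N.density j * (m ^ 2 - N.height j ^ 2) := by
    set b := |a| / (Real.pi * N.density j) with hb
    have hb0 : 0 ≤ b := by positivity
    have hba : Real.pi * N.density j * b = |a| := mul_div_cancel₀ _ hpos.ne'
    refine ⟨N.height j + b + 1, by linarith, ?_⟩
    have h1 : b ≤ (N.height j + b + 1) ^ 2 - N.height j ^ 2 := by
      nlinarith [N.height_nonneg j, mul_nonneg (N.height_nonneg j) hb0]
    calc a ≤ |a| := le_abs_self a
      _ = Real.pi * N.density j * b := hba.symm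
      _ ≤ _ := by gcongr
  have hm0' : 0 ≤ m := (N.height_nonneg j).trans hm0
  have hς := N.txPower_pos j
  have hs : 0 ≤ ∑ c, m ^ N.pathloss c := Finset.sum_nonneg fun c _ => Real.rpow_nonneg hm0' _
  -- The sum dominates m^α for each channel at once, so every radius of tier `j` is at least `m`.
  refine ⟨(∑ c, m ^ N.pathloss c) / N.txPower j, div_nonneg hs hς.le,
    hm.trans (N.le_meanCount _ j hm0 fun c => ?_)⟩
  rw [mul_div_cancel₀ _ hς.ne']
  calc m = (m ^ N.pathloss c) ^ (1 / N.pathloss c) := by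
        rw [← Real.rpow_mul hm0', mul_one_div_cancel (N.pathloss_pos c).ne', Real.rpow_one]
    _ ≤ _ := Real.rpow_le_rpow (Real.rpow_nonneg hm0' _)
        (Finset.single_le_sum (f := fun c => m ^ N.pathloss c)
          (fun c _ => Real.rpow_nonneg hm0' _) (Finset.mem_univ c))
        (one_div_nonneg.2 (N.pathloss_pos c).le)

theorem exists_powerCount_eq (hK : 0 < K) {a : ℝ} (ha : 0 ≤ a) : ∃ t, 0 ≤ t ∧ N.powerCount t = a := by
  obtain ⟨T, hT0, hT⟩ := N.exists_le_powerCount hK a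
  obtain ⟨t, ht, hta⟩ := intermediate_value_Icc hT0 N.continuous_powerCount.continuousOn
    (show a ∈ Icc _ _ from ⟨by rwa [powerCount_zero], hT⟩)
  exact ⟨t, ht.1, hta⟩

/-- The mean number of base stations with weighted average received power at least `1 / t`. -/
theorem intensity_mul_pathGain_le {η : Fin K → ℝ} (hη : ∀ j, 0 < η j) {t : ℝ} (ht : 0 ≤ t) :
    N.intensity {z | η z.1 * N.pathGain z ≤ t} =
      ENNReal.ofReal (N.meanCount fun j c => (N.txPower j * t / η j) ^ (1 / N.pathloss c)) := by
  rw [← intensity_linkDist_le]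
  congr 1
  ext ⟨j, c, y⟩
  have hς := N.txPower_pos j
  have hj := hη j
  have hx := N.linkDist_nonneg j y
  change η j * (N.linkDist j y ^ N.pathloss c / N.txPower j) ≤ t ↔
    N.linkDist j y ≤ (N.txPower j * t / η j) ^ (1 / N.pathloss c)
  rw [one_div, Real.le_rpow_inv_iff_of_pos hx (by positivity) (N.pathloss_pos c), le_div_iff₀ hj,
    ← div_le_iff₀' hς]
  constructor <;> intro h <;> refine le_of_eq_of_le ?_ h <;> ring

theorem intensity_pathGain_le {t : ℝ} (ht : 0 ≤ t) :
    N.intensity {z | N.pathGain z ≤ t} = ENNReal.ofReal (N.powerCount t) := by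
  simpa [powerCount] using N.intensity_mul_pathGain_le (η := fun _ => 1) (fun _ => one_pos) ht

/-- `powerCount` is continuous, vanishes at 0 and is unbounded, hence attains every `a ≥ 0`; and the
points of path gain at most t have mass `powerCount t`. -/
theorem isLevel (hK : 0 < K) : IsLevel N.intensity N.level where
  measurable := by
    have : N.level = N.powerCount ∘ N.pathGain := funext N.level_eq
    rw [this]
    exact N.continuous_powerCount.measurable.comp N.measurable_pathGain
  measure_le a ha := by
    refine le_antisymm ?_ ?_
    · have hub : ∀ a', a < a' → N.intensity {z | N.level z ≤ a} ≤ ENNReal.ofReal a' := by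
        intro a' haa'
        obtain ⟨t, ht, hta⟩ := N.exists_powerCount_eq hK (ha.trans haa'.le)
        rw [← hta, ← N.intensity_pathGain_le ht]
        refine measure_mono fun z hz => ?_
        have hz' : N.level z ≤ a := hz
        by_contra hlt
        have hlt' : t < N.pathGain z := not_le.1 hlt
        have := N.powerCount_mono ht hlt'.le
        rw [← level_eq, hta] at this
        linarith
      refine ge_of_tendsto (x := nhdsWithin a (Ioi a)) (f := fun x => ENNReal.ofReal x) ?_
        (Filter.eventually_of_mem self_mem_nhdsWithin hub)
      exact ENNReal.continuous_ofReal.continuousAt.tendsto.mono_left nhdsWithin_le_nhds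
    · obtain ⟨t, ht, hta⟩ := N.exists_powerCount_eq hK ha
      rw [← hta, ← N.intensity_pathGain_le ht]
      refine measure_mono fun z hz => ?_
      change N.level z ≤ N.powerCount t
      rw [level_eq]
      exact N.powerCount_mono (N.pathGain_nonneg z) hz

theorem coopMean_eq (k : Fin K) (c₀ : Channel) {r : ℝ} (hr : 0 ≤ r) :
    N.coopMean k c₀ r = N.meanCount fun j c =>
      (N.txPower j * (r ^ N.pathloss c₀ / N.txPower k) / N.threshold j k) ^ (1 / N.pathloss c) := by
  unfold coopMean
  congr 1
  funext j c
  have hj := N.txPower_pos j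
  have hk := N.txPower_pos k
  have hη := N.threshold_pos j k
  rw [N.theta_eq j c k c₀ hr, Real.div_rpow (by positivity) hη.le, neg_div, Real.rpow_neg hη.le,
    ← div_eq_mul_inv]

/-- The mean number of base stations that would cooperate with the main link base station `z`. -/
theorem intensity_threshold_mul_pathGain_le (z : Fin K × Channel × Plane) :
    N.intensity {z' | N.threshold z'.1 z.1 * N.pathGain z' ≤ N.pathGain z} =
      ENNReal.ofReal (N.coopMean z.1 z.2.1 (N.linkDist z.1 z.2.2)) := by
  rw [N.coopMean_eq _ _ (N.linkDist_nonneg _ _)]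
  exact N.intensity_mul_pathGain_le (η := fun j => N.threshold j z.1)
    (fun j => N.threshold_pos j z.1) (N.pathGain_nonneg z)

theorem intensity_pathGain_nonpos : N.intensity {z | N.pathGain z ≤ 0} = 0 := by
  rw [N.intensity_pathGain_le le_rfl, powerCount_zero, ENNReal.ofReal_zero]

theorem measurable_coopMean (k : Fin K) (c₀ : Channel) : Measurable (N.coopMean k c₀) := by
  unfold coopMean
  refine N.continuous_meanCount.measurable.comp (measurable_pi_lambda _ fun j =>
    measurable_pi_lambda _ fun c => ?_)
  unfold theta
  fun_prop

theorem measurable_mainLinkWeight (k : Fin K) (c₀ : Channel) : Measurable (N.mainLinkWeight k c₀) := by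
  have h1 : Measurable fun r => N.meanCount fun j c => N.theta j c k c₀ r := by
    refine N.continuous_meanCount.measurable.comp (measurable_pi_lambda _ fun j =>
      measurable_pi_lambda _ fun c => ?_)
    unfold theta
    fun_prop
  have h2 := N.measurable_chanProb k c₀
  unfold mainLinkWeight
  fun_prop

theorem mainLinkWeight_nonneg (k : Fin K) (c₀ : Channel) {r : ℝ} (hr : 0 ≤ r) :
    0 ≤ N.mainLinkWeight k c₀ r := by
  have h1 := N.chanProb_nonneg k c₀ r
  have h2 := N.density_pos k
  unfold mainLinkWeight
  positivity

theorem coopMean_nonneg (k : Fin K) (c₀ : Channel) (r : ℝ) : 0 ≤ N.coopMean k c₀ r :=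
  N.meanCount_nonneg _

/-- The law of the main link distance, as an integral over the base stations of one tier with one
channel environment. -/
theorem lintegral_mainLink (k : Fin K) (c₀ : Channel) {g : ℝ → ℝ≥0∞} (hg : Measurable g) :
    ENNReal.ofReal (N.density k) * ∫⁻ y, ENNReal.ofReal (N.chanProb k c₀ (N.linkDist k y)) *
        (ENNReal.ofReal (Real.exp (-N.level (k, c₀, y))) * g (N.linkDist k y)) =
      ∫⁻ r in Ici (N.height k), ENNReal.ofReal (N.mainLinkWeight k c₀ r) * g r := by
  have h1 : Measurable fun r => N.meanCount fun j c => N.theta j c k c₀ r := by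
    refine N.continuous_meanCount.measurable.comp (measurable_pi_lambda _ fun j =>
      measurable_pi_lambda _ fun c => ?_)
    unfold theta
    fun_prop
  have h2 := N.measurable_chanProb k c₀
  have hm : Measurable fun r => ENNReal.ofReal (N.chanProb k c₀ r) *
      (ENNReal.ofReal (Real.exp (-N.meanCount fun j c => N.theta j c k c₀ r)) * g r) := by
    fun_prop
  rw [show (∫⁻ y, ENNReal.ofReal (N.chanProb k c₀ (N.linkDist k y)) *
        (ENNReal.ofReal (Real.exp (-N.level (k, c₀, y))) * g (N.linkDist k y))) = _ from
      N.lintegral_comp_linkDist k hm, ← lintegral_const_mul']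
  · refine setLIntegral_congr_fun measurableSet_Ici fun r hr => ?_
    have hr0 : 0 ≤ r := (N.height_nonneg k).trans hr
    have h3 := N.chanProb_nonneg k c₀ r
    have h4 := (N.density_pos k).le
    simp only [← mul_assoc]
    rw [← ENNReal.ofReal_mul h4, ← ENNReal.ofReal_mul (by positivity),
      ← ENNReal.ofReal_mul (by positivity), mainLinkWeight]
    congr 2
    ring
  · exact ENNReal.ofReal_ne_top

/-- Counts grow at most quadratically in the radius, which is a multiple of r^(α₀/α); since α ≥ 2,
the exponent 2α₀/α is at most α₀. The summand 1 takes care of r ≤ 1. -/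
theorem coopMean_le (k : Fin K) (c₀ : Channel) :
    ∃ A, 0 ≤ A ∧ ∀ r, 0 ≤ r → N.coopMean k c₀ r ≤ A * (1 + r ^ N.pathloss c₀) := by
  let b : Fin K → Channel → ℝ := fun j c =>
    (N.txPower j / N.txPower k) ^ (1 / N.pathloss c) * N.threshold j k ^ (-1 / N.pathloss c)
  refine ⟨∑ j, 2 * Real.pi * N.density j * ∑ c, b j c ^ 2, Finset.sum_nonneg fun j _ =>
    mul_nonneg (mul_nonneg Real.two_pi_pos.le (N.density_pos j).le)
      (Finset.sum_nonneg fun c _ => sq_nonneg _), fun r hr => ?_⟩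
  rw [coopMean, meanCount, Finset.sum_mul]
  refine Finset.sum_le_sum fun j _ => ?_
  rw [mul_assoc _ (∑ c, b j c ^ 2), Finset.sum_mul]
  refine mul_le_mul_of_nonneg_left (Finset.sum_le_sum fun c _ => ?_)
    (mul_nonneg Real.two_pi_pos.le (N.density_pos j).le)
  refine (N.setIntegral_chanProb_le j c _).trans ?_
  rw [show N.theta j c k c₀ r * N.threshold j k ^ (-1 / N.pathloss c) =
    b j c * r ^ (N.pathloss c₀ / N.pathloss c) by simp only [theta, b]; ring, mul_pow]
  refine mul_le_mul_of_nonneg_left ?_ (sq_nonneg _)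
  have h0 := N.pathloss_pos c₀
  have hc := N.pathloss_pos c
  rw [← Real.rpow_natCast, ← Real.rpow_mul hr]
  rcases le_total r 1 with h1 | h1
  · refine (Real.rpow_le_one hr h1 (by positivity)).trans ?_
    linarith [Real.rpow_nonneg hr (N.pathloss c₀)]
  · have : r ^ (N.pathloss c₀ / N.pathloss c * (2 : ℕ)) ≤ r ^ N.pathloss c₀ := by
      refine Real.rpow_le_rpow_of_exponent_le h1 ?_
      rw [div_mul_eq_mul_div, div_le_iff₀ hc]
      have := N.two_le_pathloss c
      push_cast
      gcongr
    linarith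

/-- In tier `k` itself the radii are r^(α₀/α), which for r ≥ 1 are at least r^γ with γ the least
exponent. The mean count in the exponential is then at least of order r^(2γ). -/
theorem mainLinkWeight_le (k : Fin K) (c₀ : Channel) :
    ∃ A p b : ℝ, 0 ≤ A ∧ 0 < p ∧ 0 < b ∧
      ∀ r, 0 ≤ r → N.mainLinkWeight k c₀ r ≤ A * (r * Real.exp (-b * r ^ p)) := by
  let γ := min (N.pathloss c₀ / N.pathloss .los) (N.pathloss c₀ / N.pathloss .nlos)
  have hγ : 0 < γ := lt_min (div_pos (N.pathloss_pos _) (N.pathloss_pos _))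
    (div_pos (N.pathloss_pos _) (N.pathloss_pos _))
  have hγc : ∀ c, γ ≤ N.pathloss c₀ / N.pathloss c := fun c => by
    cases c
    · exact min_le_left _ _
    · exact min_le_right _ _
  have hd := N.density_pos k
  set b := Real.pi * N.density k with hb
  have hb0 : 0 < b := mul_pos Real.pi_pos hd
  refine ⟨2 * Real.pi * N.density k * Real.exp (b * (N.height k ^ 2 + 1)), γ * 2, b, by positivity,
    by positivity, hb0, fun r hr => ?_⟩
  -- The `- 1` makes the left side nonpositive for r ≤ 1, where r^γ need not be a lower bound for
  -- the radii.
  have hcount : b * (r ^ (γ * 2) - N.height k ^ 2 - 1) ≤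
      N.meanCount fun j c => N.theta j c k c₀ r := by
    have hsq : r ^ (γ * 2) = (r ^ γ) ^ 2 := by
      rw [← Real.rpow_natCast, ← Real.rpow_mul hr]
      norm_num
    have hnn := N.meanCount_nonneg fun j c => N.theta j c k c₀ r
    rcases le_total r 1 with h1 | h1
    · refine le_trans (mul_nonpos_of_nonneg_of_nonpos hb0.le ?_) hnn
      have := Real.rpow_le_one hr h1 (by positivity : 0 ≤ γ * 2)
      nlinarith [sq_nonneg (N.height k)]
    · rcases le_total (N.height k) (r ^ γ) with h2 | h2
      · refine le_trans ?_ (N.le_meanCount _ k h2 fun c => ?_)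
        · rw [hsq]
          exact mul_le_mul_of_nonneg_left (by linarith) hb0.le
        · rw [theta, div_self (N.txPower_pos k).ne', Real.one_rpow, one_mul]
          exact Real.rpow_le_rpow_of_exponent_le h1 (hγc c)
      · refine le_trans (mul_nonpos_of_nonneg_of_nonpos hb0.le ?_) hnn
        have := pow_le_pow_left₀ (Real.rpow_nonneg hr γ) h2 2
        rw [hsq]
        linarith
  calc N.mainLinkWeight k c₀ r
      = 2 * Real.pi * N.density k * r * N.chanProb k c₀ r *
          Real.exp (-N.meanCount fun j c => N.theta j c k c₀ r) := rfl
    _ ≤ 2 * Real.pi * N.density k * r * 1 *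
          Real.exp (-(b * (r ^ (γ * 2) - N.height k ^ 2 - 1))) := by
        gcongr
        exact N.chanProb_le_one k c₀ r
    _ = _ := by
        rw [show -(b * (r ^ (γ * 2) - N.height k ^ 2 - 1)) =
          b * (N.height k ^ 2 + 1) + -b * r ^ (γ * 2) by ring, Real.exp_add]
        ring

theorem integrableOn_mainLinkWeight_mul_coopMean (k : Fin K) (c₀ : Channel) :
    IntegrableOn (fun r => N.mainLinkWeight k c₀ r * N.coopMean k c₀ r) (Ici (N.height k)) := by
  obtain ⟨A, hA, hcoop⟩ := N.coopMean_le k c₀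
  obtain ⟨B, p, b, hB, hp, hb, hweight⟩ := N.mainLinkWeight_le k c₀
  have h0 := N.pathloss_pos c₀
  have h1 := integrableOn_rpow_mul_exp_neg_mul_rpow (p := p) (s := 1) (by norm_num) hp hb
  have h2 := integrableOn_rpow_mul_exp_neg_mul_rpow (p := p) (s := 1 + N.pathloss c₀)
    (by linarith) hp hb
  have hdom := (h1.add h2).const_mul (B * A)
  have hIoi : IntegrableOn (fun r => N.mainLinkWeight k c₀ r * N.coopMean k c₀ r) (Ioi 0) := by
    refine Integrable.mono' hdom ((N.measurable_mainLinkWeight k c₀).mul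
      (N.measurable_coopMean k c₀)).aestronglyMeasurable
      ((ae_restrict_iff' measurableSet_Ioi).2 (Filter.Eventually.of_forall fun r hr => ?_))
    have hr0 : 0 < r := hr
    have hw := N.mainLinkWeight_nonneg k c₀ hr0.le
    have hc := N.coopMean_nonneg k c₀ r
    rw [Real.norm_eq_abs, abs_of_nonneg (mul_nonneg hw hc)]
    calc _ ≤ B * (r * Real.exp (-b * r ^ p)) * (A * (1 + r ^ N.pathloss c₀)) :=
          mul_le_mul (hweight r hr0.le) (hcoop r hr0.le) hc (by positivity)
      _ = _ := by
          simp only [Pi.add_apply]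
          rw [Real.rpow_add hr0, Real.rpow_one]
          ring
  rw [← integrableOn_Ici_iff_integrableOn_Ioi] at hIoi
  exact hIoi.mono_set (Ici_subset_Ici.2 (N.height_nonneg k))

end Network
end UDN

/-! ### The main link station and the mean number of cooperating stations. -/

namespace UDN

theorem IsLevel.map_eq {E : Type*} [MeasurableSpace E] {ν : Measure E} {u : E → ℝ}
    (hu : IsLevel ν u) : ν.map u = volume.restrict (Ici 0) := by
  refine ext_of_Iic_of_ne_top fun R => ?_
  have h1 : ν.map u (Iic R) = ENNReal.ofReal R := by
    rw [Measure.map_apply hu.measurable measurableSet_Iic]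
    rcases le_total 0 R with hR | hR
    · exact hu.measure_le R hR
    · rw [ENNReal.ofReal_of_nonpos hR]
      exact measure_mono_null (subset_sublevel_trans subset_rfl hR) hu.measure_nonpos
  rw [h1]
  refine ⟨ENNReal.ofReal_ne_top, ?_⟩
  rw [Measure.restrict_apply measurableSet_Iic, inter_comm, Ici_inter_Iic, Real.volume_Icc, sub_zero]

/-- Pushed forward by `u`, this is Γ(2). The value 1 stands for the main link station in the final
count. -/
theorem IsLevel.lintegral_exp_neg_mul {E : Type*} [MeasurableSpace E] {ν : Measure E} {u : E → ℝ}
    (hu : IsLevel ν u) :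
    ∫⁻ z, ENNReal.ofReal (Real.exp (-u z)) * ENNReal.ofReal (u z) ∂ν = 1 := by
  have hm : Measurable fun t : ℝ => ENNReal.ofReal (Real.exp (-t)) * ENNReal.ofReal t := by fun_prop
  rw [← lintegral_map hm hu.measurable, hu.map_eq, setLIntegral_congr Ioi_ae_eq_Ici.symm]
  have h2 := Real.Gamma_eq_integral (s := 2) two_pos
  rw [Real.Gamma_two] at h2
  rw [← ENNReal.ofReal_one, h2, ofReal_integral_eq_lintegral_ofReal
    (Real.GammaIntegral_convergent two_pos) ((ae_restrict_iff' measurableSet_Ioi).2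
      (Filter.Eventually.of_forall fun t (ht : 0 < t) => by
        change 0 ≤ Real.exp (-t) * t ^ (2 - 1 : ℝ); positivity))]
  refine setLIntegral_congr_fun measurableSet_Ioi fun t _ => ?_
  rw [← ENNReal.ofReal_mul (Real.exp_pos _).le]
  norm_num

variable {K : ℕ} {N : Network K} {Ω : Type*} {Y : Fin K → ℕ → Ω → Plane}
  {C : Fin K → ℕ → Ω → Channel}

theorem arlp_eq_inv (s : Fin K × ℕ) (ω : Ω) :
    arlp N Y C s ω = (N.pathGain (site Y C s ω))⁻¹ := N.avgPower_eq_inv (site Y C s ω)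

namespace Network

variable (N)

theorem lintegral_intensity_exp_neg_level_mul {g : Fin K → Channel → ℝ → ℝ≥0∞}
    (hg : ∀ k c₀, Measurable (g k c₀)) (hK : 0 < K) :
    ∫⁻ z, ENNReal.ofReal (Real.exp (-N.level z)) * g z.1 z.2.1 (N.linkDist z.1 z.2.2)
        ∂N.intensity =
      ∑ k, ∑ c₀, ∫⁻ r in Ici (N.height k), ENNReal.ofReal (N.mainLinkWeight k c₀ r) * g k c₀ r := by
  have hgm : Measurable fun z : Fin K × Channel × Plane => g z.1 z.2.1 (N.linkDist z.1 z.2.2) := by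
    refine measurable_from_prod_countable_right fun j => measurable_from_prod_countable_right
      fun c => ?_
    exact (hg j c).comp (N.measurable_linkDist j)
  have hlm : Measurable fun z => ENNReal.ofReal (Real.exp (-N.level z)) :=
    (Real.measurable_exp.comp (N.isLevel hK).measurable.neg).ennreal_ofReal
  refine (N.lintegral_intensity (hlm.mul hgm)).trans ?_
  exact Finset.sum_congr rfl fun k _ => Finset.sum_congr rfl fun c₀ _ =>
    N.lintegral_mainLink k c₀ (hg k c₀)

theorem assocProb_nonneg (k : Fin K) (c₀ : Channel) : 0 ≤ N.assocProb k c₀ :=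
  setIntegral_nonneg measurableSet_Ici fun _ hr =>
    N.mainLinkWeight_nonneg k c₀ ((N.height_nonneg k).trans hr)

/-- The pairs of base stations such that the second one cooperates if the first one is the main link
base station. -/
def coopPairs : Set ((Fin K × Channel × Plane) × (Fin K × Channel × Plane)) :=
  {p | N.threshold p.2.1 p.1.1 * N.pathGain p.2 ≤ N.pathGain p.1}

theorem measurableSet_coopPairs : MeasurableSet N.coopPairs := by
  have h1 : Measurable fun q : Fin K × Fin K => N.threshold q.1 q.2 := measurable_of_countable _
  have h2 : Measurable fun p : (Fin K × Channel × Plane) × (Fin K × Channel × Plane) =>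
      N.threshold p.2.1 p.1.1 := h1.comp (by fun_prop : Measurable fun p :
        (Fin K × Channel × Plane) × (Fin K × Channel × Plane) => (p.2.1, p.1.1))
  exact measurableSet_le (h2.mul (N.measurable_pathGain.comp measurable_snd))
    (N.measurable_pathGain.comp measurable_fst)

/-- Split the base stations that would cooperate with `z` according to their level. -/
theorem coopMean_eq_level_add (hK : 0 < K) (z : Fin K × Channel × Plane) :
    ENNReal.ofReal (N.coopMean z.1 z.2.1 (N.linkDist z.1 z.2.2)) = ENNReal.ofReal (N.level z) +
      N.intensity {z' | N.level z < N.level z' ∧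
        N.threshold z'.1 z.1 * N.pathGain z' ≤ N.pathGain z} := by
  have hu := N.isLevel hK
  set T := {z' : Fin K × Channel × Plane | N.threshold z'.1 z.1 * N.pathGain z' ≤ N.pathGain z}
  set A := {z' | N.level z' ≤ N.level z}
  have hA : MeasurableSet A := measurableSet_le hu.measurable measurable_const
  have hνA : N.intensity A = ENNReal.ofReal (N.level z) := hu.measure_le _ (N.meanCount_nonneg _)
  -- Since thresholds are at most 1, `T ∩ A` lies between the points at least as strong as `z` and
  -- the points of level at most that of `z`; both have mass `level z`.
  have hsub : {z' | N.pathGain z' ≤ N.pathGain z} ⊆ T ∩ A := by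
    intro z' hz'
    have h1 : N.pathGain z' ≤ N.pathGain z := hz'
    refine ⟨(mul_le_of_le_one_left (N.pathGain_nonneg z') (N.threshold_le_one _ _)).trans h1, ?_⟩
    change N.level z' ≤ N.level z
    rw [level_eq, level_eq]
    exact N.powerCount_mono (N.pathGain_nonneg z') h1
  have hTA : N.intensity (T ∩ A) = ENNReal.ofReal (N.level z) := by
    refine le_antisymm ((measure_mono inter_subset_right).trans hνA.le) ?_
    rw [level_eq, ← N.intensity_pathGain_le (N.pathGain_nonneg z)]
    exact measure_mono hsub
  rw [← N.intensity_threshold_mul_pathGain_le, ← hTA, ← measure_inter_add_sdiff T hA]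
  congr 2
  ext z'
  simp [T, A, and_comm]

end Network

theorem coopCount_eq_tsum [MeasurableSpace Ω] (ω : Ω) :
    coopCount N Y C ω = ∑' s, {ω | s ∈ coopSet N Y C ω}.indicator 1 ω := by
  rw [coopCount, ← ENNReal.tsum_set_one, tsum_subtype (coopSet N Y C ω) fun _ => (1 : ℝ≥0∞)]
  rfl

namespace IsDeployment

variable [MeasurableSpace Ω] {P : Measure Ω} [IsProbabilityMeasure P] (h : IsDeployment N P Y C) (hK : 0 < K)

include h hK in
-- The level is a monotone, not necessarily strictly monotone, function of the path gain; still, a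
-- strict inequality of levels forces one of path gains, so the point of strictly least level is the
-- only strongest station. Positive path gains are needed because `0⁻¹ = 0` would give a station at
-- link distance 0 no power.
theorem ae_main : ∀ᵐ ω ∂P, (∀ s, 0 < N.pathGain (site Y C s ω)) ∧
    ∃ m, (∀ s, s ≠ m → N.level (site Y C m ω) < N.level (site Y C s ω)) ∧
      (∀ i, IsFirst (site Y C) N.level i ω ↔ i = m) ∧ ∀ i, IsMain N Y C i ω ↔ i = m := by
  filter_upwards [h.isPoissonCloud.ae_exists_first (N.isLevel hK),
    h.isPoissonCloud.ae_notMem_of_null (measurableSet_le N.measurable_pathGain measurable_const)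
      N.intensity_pathGain_nonpos] with ω ⟨m, hm⟩ hpos
  have hpos' : ∀ s, 0 < N.pathGain (site Y C s ω) := fun s => not_le.1 (hpos s)
  have hlt : ∀ s, s ≠ m → N.pathGain (site Y C m ω) < N.pathGain (site Y C s ω) := by
    intro s hs
    by_contra hle
    have h1 := N.powerCount_mono (hpos' s).le (not_lt.1 hle)
    rw [← N.level_eq, ← N.level_eq] at h1
    exact absurd h1 (hm s hs).not_ge
  refine ⟨hpos', m, hm, fun i => ⟨fun hi => ?_, ?_⟩, fun i => ⟨fun hi => ?_, ?_⟩⟩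
  · by_contra hne
    exact absurd (hi m) (hm i hne).not_ge
  · rintro rfl s
    rcases eq_or_ne s i with rfl | hne
    · exact le_rfl
    · exact (hm s hne).le
  · by_contra hne
    have h1 := hi m
    rw [arlp_eq_inv, arlp_eq_inv, inv_le_inv₀ (hpos' m) (hpos' i)] at h1
    exact absurd h1 (hlt i hne).not_ge
  · rintro rfl s
    rw [arlp_eq_inv, arlp_eq_inv, inv_le_inv₀ (hpos' s) (hpos' i)]
    rcases eq_or_ne s i with rfl | hne
    · exact le_rfl
    · exact (hlt s hne).le

include h hK in
-- Up to a null set the event says that the first point lies in `D`; its law exp(-u) dν is then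
-- written in terms of the link distance.
theorem measure_mainEvent (k : Fin K) (c₀ : Channel) {B : Set ℝ} (hB : MeasurableSet B) :
    P (mainEvent N Y C k c₀ B) =
      ∫⁻ r in Ici (N.height k) ∩ B, ENNReal.ofReal (N.mainLinkWeight k c₀ r) := by
  classical
  set D : Set (Fin K × Channel × Plane) :=
    {z | z.1 = k ∧ z.2.1 = c₀ ∧ N.linkDist z.1 z.2.2 ∈ B} with hD
  have hmD : MeasurableSet D := by
    refine (measurable_fst (measurableSet_singleton k)).inter
      (((measurable_fst.comp measurable_snd) (measurableSet_singleton c₀)).inter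
        (N.measurable_linkDist_snd hB))
  have h1 : P (mainEvent N Y C k c₀ B) = P (firstIn (site Y C) N.level D) := by
    refine measure_congr ?_
    filter_upwards [h.ae_main hK] with ω ⟨_, m, _, hf, hmain⟩
    refine propext ⟨fun ⟨i, hi, hc, hB⟩ => ?_, fun ⟨s, hs, hsk, hc, hsB⟩ => ?_⟩
    · exact ⟨(k, i), (hf _).2 ((hmain _).1 hi), rfl, hc, hB⟩
    · obtain ⟨j, i⟩ := s
      obtain rfl : j = k := hsk
      exact ⟨i, (hmain _).2 ((hf _).1 hs), hc, hsB⟩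
  have hg : ∀ k' c, Measurable fun r => if k' = k ∧ c = c₀ then B.indicator (1 : ℝ → ℝ≥0∞) r
      else 0 := fun k' c => by
    split_ifs
    · exact measurable_one.indicator hB
    · exact measurable_const
  have h2 := N.lintegral_intensity_exp_neg_level_mul hg hK
  rw [h1, h.isPoissonCloud.measure_firstIn_eq (N.isLevel hK) hmD, ← lintegral_indicator hmD]
  refine Eq.trans (lintegral_congr fun z => ?_) (h2.trans ?_)
  · by_cases hz : z ∈ D
    · obtain ⟨hz1, hz2, hz3⟩ := id hz
      rw [indicator_of_mem hz, if_pos ⟨hz1, hz2⟩, indicator_of_mem hz3, Pi.one_apply, mul_one]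
    · rw [indicator_of_notMem hz]
      by_cases hz' : z.1 = k ∧ z.2.1 = c₀
      · rw [if_pos hz', indicator_of_notMem fun hz3 => hz ⟨hz'.1, hz'.2, hz3⟩, mul_zero]
      · rw [if_neg hz', mul_zero]
  · rw [Finset.sum_eq_single k (fun k' _ hk' => Finset.sum_eq_zero fun c _ => by simp [hk'])
      (by simp), Finset.sum_eq_single c₀ (fun c _ hc => by simp [hc]) (by simp), inter_comm,
      ← setLIntegral_indicator hB]
    refine lintegral_congr fun r => ?_
    by_cases hr : r ∈ B <;> simp [hr]

include h hK in
theorem integrableOn_mainLinkWeight (k : Fin K) (c₀ : Channel) :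
    IntegrableOn (N.mainLinkWeight k c₀) (Ici (N.height k)) := by
  refine ⟨(N.measurable_mainLinkWeight k c₀).aestronglyMeasurable, ?_⟩
  rw [hasFiniteIntegral_iff_ofReal ((ae_restrict_iff' measurableSet_Ici).2
    (Filter.Eventually.of_forall fun _ hr =>
      N.mainLinkWeight_nonneg k c₀ ((N.height_nonneg k).trans hr)))]
  have h1 := h.measure_mainEvent hK k c₀ MeasurableSet.univ
  rw [inter_univ] at h1
  rw [← h1]
  exact measure_lt_top _ _

include h hK in
theorem ofReal_assocProb (k : Fin K) (c₀ : Channel) :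
    ENNReal.ofReal (N.assocProb k c₀) =
      ∫⁻ r in Ici (N.height k), ENNReal.ofReal (N.mainLinkWeight k c₀ r) :=
  ofReal_integral_eq_lintegral_ofReal (h.integrableOn_mainLinkWeight hK k c₀)
    ((ae_restrict_iff' measurableSet_Ici).2 (Filter.Eventually.of_forall fun _ hr =>
      N.mainLinkWeight_nonneg k c₀ ((N.height_nonneg k).trans hr)))

include h hK in
-- For conditioning on a null event: division by zero makes `mainLinkPdf` vanish, and so do the
-- unconditional integrals it is compared with.
theorem ae_mainLinkWeight_eq_zero {k : Fin K} {c₀ : Channel} (h0 : N.assocProb k c₀ = 0) :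
    ∀ᵐ r ∂volume.restrict (Ici (N.height k)), N.mainLinkWeight k c₀ r = 0 :=
  (integral_eq_zero_iff_of_nonneg_ae ((ae_restrict_iff' measurableSet_Ici).2
    (Filter.Eventually.of_forall fun _ hr =>
      N.mainLinkWeight_nonneg k c₀ ((N.height_nonneg k).trans hr)))
    (h.integrableOn_mainLinkWeight hK k c₀)).1 h0

include h hK in
theorem assocProb_mul_lintegral_mainLinkPdf (k : Fin K) (c₀ : Channel) (B : Set ℝ) :
    ENNReal.ofReal (N.assocProb k c₀) *
        ∫⁻ r in Ici (N.height k) ∩ B, ENNReal.ofReal (N.mainLinkPdf k c₀ r) =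
      ∫⁻ r in Ici (N.height k) ∩ B, ENNReal.ofReal (N.mainLinkWeight k c₀ r) := by
  rw [← lintegral_const_mul' _ _ ENNReal.ofReal_ne_top]
  refine lintegral_congr_ae ?_
  rcases eq_or_ne (N.assocProb k c₀) 0 with h0 | h0
  · filter_upwards [ae_restrict_of_ae_restrict_of_subset inter_subset_left
      (h.ae_mainLinkWeight_eq_zero hK h0)] with r hr
    simp [h0, hr]
  · refine Filter.Eventually.of_forall fun r => ?_
    simp only
    rw [← ENNReal.ofReal_mul (N.assocProb_nonneg k c₀), Network.mainLinkPdf, mul_div_cancel₀ _ h0]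

include h hK in
theorem assocProb_mul_integral_coopMean (k : Fin K) (c₀ : Channel) :
    N.assocProb k c₀ * ∫ r in Ici (N.height k), N.mainLinkPdf k c₀ r * N.coopMean k c₀ r =
      ∫ r in Ici (N.height k), N.mainLinkWeight k c₀ r * N.coopMean k c₀ r := by
  rw [← integral_const_mul]
  refine integral_congr_ae ?_
  rcases eq_or_ne (N.assocProb k c₀) 0 with h0 | h0
  · filter_upwards [h.ae_mainLinkWeight_eq_zero hK h0] with r hr
    simp [h0, hr]
  · refine Filter.Eventually.of_forall fun r => ?_
    simp only
    rw [Network.mainLinkPdf, ← mul_assoc, mul_div_cancel₀ _ h0]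

omit [IsProbabilityMeasure P] in
include h in
theorem measurableSet_mem_coopSet (s : Fin K × ℕ) : MeasurableSet {ω | s ∈ coopSet N Y C ω} := by
  have hm : ∀ s, Measurable (arlp N Y C s) := fun s => by
    have : arlp N Y C s = fun ω => (N.pathGain (site Y C s ω))⁻¹ := funext (arlp_eq_inv s)
    rw [this]
    exact (N.measurable_pathGain.comp (h.measurable_site s)).inv
  have : {ω | s ∈ coopSet N Y C ω} = ⋃ m, {ω | IsMain N Y C m ω} ∩
      {ω | N.threshold s.1 m.1 ≤ arlp N Y C s ω / arlp N Y C m ω} := by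
    ext ω
    simp only [coopSet, mem_ofPred_eq, mem_iUnion, mem_inter_iff]
  rw [this]
  refine MeasurableSet.iUnion fun m => MeasurableSet.inter ?_ ?_
  · simp only [IsMain, ofPred_forall]
    exact MeasurableSet.iInter fun s => measurableSet_le (hm s) (hm m)
  · exact measurableSet_le measurable_const ((hm s).div (hm m))

omit [IsProbabilityMeasure P] in
include h in
theorem measurable_coopCount : Measurable (coopCount N Y C) := by
  have : coopCount N Y C = fun ω => ∑' s, {ω | s ∈ coopSet N Y C ω}.indicator 1 ω :=
    funext coopCount_eq_tsum
  rw [this]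
  exact Measurable.tsum fun s => measurable_one.indicator (h.measurableSet_mem_coopSet s)

include h hK in
-- A cooperating station either is the main link station, which passes its own threshold since that
-- is at most 1, or has a strictly larger level than the main link station.
theorem measure_mem_coopSet (s : Fin K × ℕ) :
    P {ω | s ∈ coopSet N Y C ω} = P {ω | IsFirst (site Y C) N.level s ω} +
      ∑' m, P {ω | IsFirst (site Y C) N.level m ω ∧
        N.level (site Y C m ω) < N.level (site Y C s ω) ∧
        (site Y C m ω, site Y C s ω) ∈ N.coopPairs} := by
  have hu := (N.isLevel hK).measurable
  have hmZ := h.measurable_site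
  have hF := measurableSet_isFirst hmZ hu
  have hG : ∀ m, MeasurableSet {ω | IsFirst (site Y C) N.level m ω ∧
      N.level (site Y C m ω) < N.level (site Y C s ω) ∧
      (site Y C m ω, site Y C s ω) ∈ N.coopPairs} := fun m =>
    (hF m).inter ((measurableSet_lt (hu.comp (hmZ m)) (hu.comp (hmZ s))).inter
      (((hmZ m).prodMk (hmZ s)) N.measurableSet_coopPairs))
  rw [← lintegral_indicator_one (h.measurableSet_mem_coopSet s), ← lintegral_indicator_one (hF s)]
  simp_rw [← fun m => lintegral_indicator_one (μ := P) (hG m)]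
  rw [← lintegral_tsum fun m => (measurable_one.indicator (hG m)).aemeasurable,
    ← lintegral_add_left (measurable_one.indicator (hF s))]
  refine lintegral_congr_ae ?_
  filter_upwards [h.ae_main hK] with ω ⟨hpos, m, hlt, hf, hmain⟩
  have hcoop : s ∈ coopSet N Y C ω ↔ (site Y C m ω, site Y C s ω) ∈ N.coopPairs := by
    have h1 : s ∈ coopSet N Y C ω ↔ N.threshold s.1 m.1 ≤ arlp N Y C s ω / arlp N Y C m ω := by
      simp [coopSet, hmain]
    rw [h1, arlp_eq_inv, arlp_eq_inv, inv_div_inv, le_div_iff₀ (hpos s)]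
    rfl
  rw [tsum_eq_single m fun m' hm' => by simp [hf, hm']]
  rcases eq_or_ne s m with rfl | hne
  · have hs : s ∈ coopSet N Y C ω := hcoop.2
      (mul_le_of_le_one_left (hpos s).le (N.threshold_le_one _ _))
    simp [hf, hs]
  · have hfirst : ω ∉ {ω | IsFirst (site Y C) N.level s ω} := fun hs => hne ((hf s).1 hs)
    rw [indicator_of_notMem hfirst, zero_add]
    by_cases hp : (site Y C m ω, site Y C s ω) ∈ N.coopPairs
    · rw [indicator_of_mem (show ω ∈ {ω | s ∈ coopSet N Y C ω} from hcoop.2 hp)]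
      refine (indicator_of_mem ?_ _).symm
      exact ⟨(hf m).2 rfl, hlt s hne, hp⟩
    · rw [indicator_of_notMem (show ω ∉ {ω | s ∈ coopSet N Y C ω} from fun hs => hp (hcoop.1 hs))]
      exact (indicator_of_notMem (fun hs => hp hs.2.2) _).symm

include h hK in
theorem lintegral_coopCount : ∫⁻ ω, coopCount N Y C ω ∂P =
    ∑ k, ∑ c₀, ∫⁻ r in Ici (N.height k),
      ENNReal.ofReal (N.mainLinkWeight k c₀ r) * ENNReal.ofReal (N.coopMean k c₀ r) := by
  have hu := N.isLevel hK
  have hZ := h.isPoissonCloud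
  have hone : ∑' s, P {ω | IsFirst (site Y C) N.level s ω} = 1 := by
    have hm := measurableSet_isFirst hZ.measurable hu.measurable
    rw [← measure_univ (μ := P), ← lintegral_one]
    simp_rw [← fun s => lintegral_indicator_one (μ := P) (hm s)]
    rw [← lintegral_tsum fun s => (measurable_one.indicator (hm s)).aemeasurable]
    refine lintegral_congr_ae ?_
    filter_upwards [h.ae_main hK] with ω ⟨_, m, _, hf, _⟩
    rw [tsum_eq_single m fun s hs => by simp [hf, hs]]
    simp [hf]
  simp_rw [coopCount_eq_tsum]
  rw [lintegral_tsum fun s =>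
    (measurable_one.indicator (h.measurableSet_mem_coopSet s)).aemeasurable]
  simp_rw [fun s => lintegral_indicator_one (μ := P) (h.measurableSet_mem_coopSet s),
    h.measure_mem_coopSet hK]
  -- The 1 from the main link stations is rewritten as the integral of u exp(-u). Both terms are
  -- then integrals against exp(-u) dν, and their integrands add up to `coopMean`.
  rw [ENNReal.tsum_add, hone, ENNReal.tsum_comm, hZ.tsum_measure_isFirst_pair hu N.measurableSet_coopPairs,
    ← hu.lintegral_exp_neg_mul, ← lintegral_add_left (by have := hu.measurable; fun_prop),
    ← N.lintegral_intensity_exp_neg_level_mul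
      (fun k c₀ => (N.measurable_coopMean k c₀).ennreal_ofReal) hK]
  refine lintegral_congr fun z => ?_
  rw [N.coopMean_eq_level_add hK, mul_add]
  rfl

end IsDeployment
end UDN

end

/-! ### Assembly of the main statement. -/

theorem lemma2 {K : ℕ} (hK : 0 < K) (N : UDN.Network K)
    {Ω : Type*} [MeasurableSpace Ω] (P : Measure Ω) [IsProbabilityMeasure P]
    (Y : Fin K → ℕ → Ω → UDN.Plane) (C : Fin K → ℕ → Ω → UDN.Channel)
    (hYC : UDN.IsDeployment N P Y C) :
    -- almost surely there is exactly one main link base station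
    (∀ᵐ ω ∂P, ∃! m, UDN.IsMain N Y C m ω) ∧
    -- `assocProb` and `mainLinkPdf` are the association probability and the conditional density
    -- of the main link distance
    (∀ k c₀, P (UDN.mainEvent N Y C k c₀ univ) = ENNReal.ofReal (N.assocProb k c₀)) ∧
    (∀ k c₀ (B : Set ℝ), MeasurableSet B →
      P (UDN.mainEvent N Y C k c₀ B) = ENNReal.ofReal (N.assocProb k c₀) *
        ∫⁻ r in Ici (N.height k) ∩ B, ENNReal.ofReal (N.mainLinkPdf k c₀ r)) ∧
    -- the average number of cooperating base stations
    (∀ k c₀, IntegrableOn (fun r => N.mainLinkPdf k c₀ r * N.coopMean k c₀ r)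
      (Ici (N.height k))) ∧
    AEMeasurable (UDN.coopCount N Y C) P ∧
    ∫⁻ ω, UDN.coopCount N Y C ω ∂P =
      ENNReal.ofReal (∑ k, ∑ c₀, N.assocProb k c₀ *
        ∫ r in Ici (N.height k), N.mainLinkPdf k c₀ r * N.coopMean k c₀ r) := by
  refine ⟨?_, fun k c₀ => ?_, fun k c₀ B hB => ?_, fun k c₀ => ?_,
    hYC.measurable_coopCount.aemeasurable, ?_⟩
  · filter_upwards [hYC.ae_main hK] with ω ⟨_, m, _, _, hm⟩
    exact ⟨m, (hm m).2 rfl, fun i hi => (hm i).1 hi⟩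
  · rw [hYC.measure_mainEvent hK k c₀ MeasurableSet.univ, inter_univ, hYC.ofReal_assocProb hK]
  · rw [hYC.measure_mainEvent hK k c₀ hB, hYC.assocProb_mul_lintegral_mainLinkPdf hK]
  · refine ((N.integrableOn_mainLinkWeight_mul_coopMean k c₀).const_mul
      (N.assocProb k c₀)⁻¹).congr (Filter.Eventually.of_forall fun r => ?_)
    simp only [UDN.Network.mainLinkPdf]
    ring
  · have hnn : ∀ k c₀, 0 ≤ᵐ[volume.restrict (Ici (N.height k))]
        fun r => N.mainLinkWeight k c₀ r * N.coopMean k c₀ r := fun k c₀ =>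
      (ae_restrict_iff' measurableSet_Ici).2 (Filter.Eventually.of_forall fun r hr =>
        mul_nonneg (N.mainLinkWeight_nonneg k c₀ ((N.height_nonneg k).trans hr))
          (N.coopMean_nonneg k c₀ r))
    have hint : ∀ k c₀, 0 ≤ ∫ r in Ici (N.height k), N.mainLinkWeight k c₀ r * N.coopMean k c₀ r :=
      fun k c₀ => integral_nonneg_of_ae (hnn k c₀)
    simp_rw [hYC.assocProb_mul_integral_coopMean hK]
    rw [hYC.lintegral_coopCount hK, ENNReal.ofReal_sum_of_nonneg fun k _ =>
      Finset.sum_nonneg fun c₀ _ => hint k c₀]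
    refine Finset.sum_congr rfl fun k _ => ?_
    rw [ENNReal.ofReal_sum_of_nonneg fun c₀ _ => hint k c₀]
    refine Finset.sum_congr rfl fun c₀ _ => ?_
    rw [ofReal_integral_eq_lintegral_ofReal (N.integrableOn_mainLinkWeight_mul_coopMean k c₀)
      (hnn k c₀)]
    refine setLIntegral_congr_fun measurableSet_Ici fun r hr => ?_
    exact (ENNReal.ofReal_mul
      (N.mainLinkWeight_nonneg k c₀ ((N.height_nonneg k).trans hr))).symm
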